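/- For $0<\eta<2\pi$ let $W_\eta=\{(r,\theta): r>0,\ -\eta/2<\theta<\eta/2\}\subseteq\mathbb R^2$ (polar coordinates). Let $\mu$ be a noise measure: a compactly supported Borel probability measure on $\mathbb R^2$ with mean zero which is preserved by the orthogonal transformations that fix the first basis vector $\mathbf e_1$. Let $C$ be its covariance matrix, suppose $C_{22}>0$, and put $$p=p(\mu)=\frac{C_{11}+C_{22}+1}{C_{22}}\in(1,\infty),\qquad \alpha=1+\inf\{R:\mu(\{|x|<R\})=1\}.$$ For $v\in\mathbb R^2$ let $\mu_v=\mu\circ\Psi^{-1}$, where $\Psi$ is $|v|$ times an orthogonal transformation and $\Psi(\mathbf e_1)=v$. The tug-of-war in a domain $D$ with noise $\mu$ and step size $\varepsilon>0$ starts at $x_0\in D$. At the $k$-th turn a fair coin decides which of players I and II wins the turn. If $\operatorname{dist}(x_{k-1},\partial D)>\alpha\varepsilon$, the winner chooses $v_k$ with $|v_k|\le\varepsilon$, and $x_k=x_{k-1}+v_k+z_k$, where $z_k$ is sampled from $\mu_{v_k}$. If $\operatorname{dist}(x_{k-1},\partial D)\le\alpha\varepsilon$, the winner chooses $x_k\in\partial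 D$ with $|x_k-x_{k-1}|\le\alpha\varepsilon$, and the game ends. A strategy gives a player's choice at each turn as a Borel measurable function of the game history $(x_0,v_1,x_1,\dots,v_{k-1},x_{k-1})$. Let $\tau\in\{1,2,\dots\}\cup\{\infty\}$ be the time at which the game ends. For fixed $\varepsilon>0$ let $\mathcal A$ be the set of all $\eta\in(0,2\pi)$ for which there is a strategy of player II such that, for the game in $W_\eta$, $E_{x_0}[\tau]<\infty$ for all $x_0\in W_\eta$, regardless of the strategy used by player I. The critical angle is $\eta_p=\sup\mathcal A$. **Corollary 1.4.** For every such $\mu$ and every $\varepsilon>0$, the critical angle satisfies $$\eta_p\ \ge\ \pi\left[1-\frac12\sqrt{\frac{2(p-1)}{p}}\,\right].$$ -/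

import Mathlib

open MeasureTheory ProbabilityTheory
open scoped ENNReal

namespace TugOfWar

/-! The plane is identified with the complex numbers; the first basis vector is `1`. -/

/-- The open wedge of aperture `η` (for `0 < η < 2π`), in polar coordinates
`r > 0`, `-η/2 < θ < η/2`. -/
def wedge (η : ℝ) : Set ℂ :=
  {z | z ≠ 0 ∧ -(η / 2) < z.arg ∧ z.arg < η / 2}

/-- A noise measure: a compactly supported Borel probability measure on the plane with mean zero,
preserved by every orthogonal transformation that fixes the first basis vector. -/
structure IsNoiseMeasure (μ : Measure ℂ) : Prop where
  isProbabilityMeasure : IsProbabilityMeasure μ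
  compactSupport : ∃ K : Set ℂ, IsCompact K ∧ μ Kᶜ = 0
  mean_zero : ∫ z, z ∂μ = 0
  map_eq : ∀ O : ℂ ≃ₗᵢ[ℝ] ℂ, O 1 = 1 → μ.map O = μ

/-- The exponent `p(μ) = (C₁₁ + C₂₂ + 1) / C₂₂`, with `C` the covariance matrix of `μ`.
If `C₂₂ > 0` it is greater than `1`; in the degenerate case `C₂₂ = 0` (where `p = ∞`) the
value of this expression is `0`, so that `1 < exponent μ` says exactly that `p` is finite. -/
noncomputable def exponent (μ : Measure ℂ) : ℝ :=
  ((∫ z, z.re ^ 2 ∂μ) + (∫ z, z.im ^ 2 ∂μ) + 1) / ∫ z, z.im ^ 2 ∂μ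

/-- `α = 1 + inf {R : μ(B_R(0)) = 1}`. -/
noncomputable def reach (μ : Measure ℂ) : ℝ :=
  1 + sInf {R : ℝ | μ (Metric.ball 0 R) = 1}

/-- Game histories `(x₀, v₁, x₁, …, vₙ, xₙ)` up to step `n`: the `k`-th entry is `(vₖ, xₖ)`,
and the entry with index `0` is `(0, x₀)`. -/
abbrev History (n : ℕ) : Type := (i : Finset.Iic n) → ℂ × ℂ

/-- The current game position `xₙ`. -/
def History.position {n : ℕ} (h : History n) : ℂ :=
  (h ⟨n, Finset.mem_Iic.2 le_rfl⟩).2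

/-- A strategy in the game of step size `ε` in `D` with noise `μ`: Borel functions of the game
history which give the vector `move n h` of length at most `ε` that the player adds to the position
when he wins turn `n + 1`, and, when the position is within `αε` of the boundary, the boundary point
`final n h` at distance at most `αε` to which he then moves. -/
structure Strategy (μ : Measure ℂ) (D : Set ℂ) (ε : ℝ) where
  move : (n : ℕ) → History n → ℂ
  final : (n : ℕ) → History n → ℂ
  measurable_move : ∀ n, Measurable (move n)
  measurable_final : ∀ n, Measurable (final n)
  norm_move_le : ∀ n h, ‖move n h‖ ≤ ε
  final_mem : ∀ n (h : History n), h.position ∈ D →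
    Metric.infDist h.position (frontier D) ≤ reach μ * ε → final n h ∈ frontier D
  dist_final_le : ∀ n (h : History n), h.position ∈ D →
    Metric.infDist h.position (frontier D) ≤ reach μ * ε →
      dist (final n h) h.position ≤ reach μ * ε

variable {μ : Measure ℂ} {D : Set ℂ} {ε : ℝ}

open Classical in
/-- The next entry `(vₙ₊₁, xₙ₊₁)` of the history, as a function of the current history `h` and of
the random input `(b, ζ)`, where `b` is the coin (player I wins if it is `true`) and `ζ` has law `μ`.

If the game has ended, nothing changes and the recorded move is `0`. If the position is within `αε`
of the boundary, then the winner moves to the boundary point he chose. Otherwise the position changes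
by `v + z`, where `v` is the winner's move and `z = v * ζ`: complex multiplication by `v` is
`|v|` times an orthogonal transformation and takes the first basis vector `1` to `v`, so `z` has the
law `μ_v`. -/
noncomputable def step (SI SII : Strategy μ D ε) (n : ℕ) (x : History n × (Bool × ℂ)) : ℂ × ℂ :=
  if x.1.position ∈ frontier D then (0, x.1.position)
  else if Metric.infDist x.1.position (frontier D) ≤ reach μ * ε then
    (0, if x.2.1 = true then SI.final n x.1 else SII.final n x.1)
  else
    let v := if x.2.1 = true then SI.move n x.1 else SII.move n x.1
    (v, x.1.position + v + v * x.2.2)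

theorem History.measurable_position {n : ℕ} : Measurable (History.position (n := n)) :=
  measurable_snd.comp (measurable_pi_apply _)

theorem measurable_step (SI SII : Strategy μ D ε) (n : ℕ) : Measurable (step SI SII n) := by
  have hpos : Measurable fun x : History n × (Bool × ℂ) => x.1.position :=
    History.measurable_position.comp measurable_fst
  have hb : MeasurableSet {x : History n × (Bool × ℂ) | x.2.1 = true} :=
    (measurable_fst.comp measurable_snd) (MeasurableSet.singleton true)
  have hv : Measurable fun x : History n × (Bool × ℂ) =>
      if x.2.1 = true then SI.move n x.1 else SII.move n x.1 :=
    Measurable.ite hb ((SI.measurable_move n).comp measurable_fst)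
      ((SII.measurable_move n).comp measurable_fst)
  have hf : Measurable fun x : History n × (Bool × ℂ) =>
      if x.2.1 = true then SI.final n x.1 else SII.final n x.1 :=
    Measurable.ite hb ((SI.measurable_final n).comp measurable_fst)
      ((SII.measurable_final n).comp measurable_fst)
  refine Measurable.ite (hpos isClosed_frontier.measurableSet) (measurable_const.prodMk hpos) ?_
  refine Measurable.ite
    (measurableSet_le (Metric.continuous_infDist_pt _ |>.measurable.comp hpos) measurable_const)
    (measurable_const.prodMk hf) ?_
  exact hv.prodMk ((hpos.add hv).add (hv.mul (measurable_snd.comp measurable_snd)))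

/-- The transition kernel of the game: the law of the next entry of the history, for a fair coin and
independent noise. -/
noncomputable def transition (SI SII : Strategy μ D ε) (n : ℕ) : Kernel (History n) (ℂ × ℂ) :=
  (Kernel.id ×ₖ Kernel.const (History n) ((PMF.uniformOfFintype Bool).toMeasure.prod μ)).map
    (step SI SII n)

instance [IsProbabilityMeasure μ] (SI SII : Strategy μ D ε) (n : ℕ) :
    IsMarkovKernel (transition SI SII n) :=
  Kernel.IsMarkovKernel.map _ (measurable_step SI SII n)

/-- The law of the complete history `(x₀, v₁, x₁, v₂, x₂, …)` of the game that starts at `x₀` and is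
played with the strategies `SI` and `SII`. -/
noncomputable def gameMeasure [IsProbabilityMeasure μ] (SI SII : Strategy μ D ε) (x₀ : ℂ) :
    Measure (ℕ → ℂ × ℂ) :=
  Kernel.traj (X := fun _ => ℂ × ℂ) (transition SI SII) 0 (fun _ => (0, x₀))

/-- The time to end the game in `D`: the first `k` with `xₖ ∈ ∂D`, and `∞` if there is none. -/
noncomputable def endTime (D : Set ℂ) (h : ℕ → ℂ × ℂ) : ℝ≥0∞ :=
  ⨅ (k : ℕ) (_ : (h k).2 ∈ frontier D), (k : ℝ≥0∞)

/-- The expected time to end the game started at `x₀`. -/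
noncomputable def expectedEndTime [IsProbabilityMeasure μ] (SI SII : Strategy μ D ε) (x₀ : ℂ) :
    ℝ≥0∞ :=
  ∫⁻ h, endTime D h ∂(gameMeasure SI SII x₀)

/-- The apertures `η ∈ (0, 2π)` for which some strategy of player II makes the expected time to end
the game in the wedge finite for every starting point, whatever the strategy of player I. -/
def finiteAngles (μ : Measure ℂ) [IsProbabilityMeasure μ] (ε : ℝ) : Set ℝ :=
  {η | η ∈ Set.Ioo 0 (2 * Real.pi) ∧
    ∃ SII : Strategy μ (wedge η) ε, ∀ SI : Strategy μ (wedge η) ε, ∀ x₀ ∈ wedge η,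
      expectedEndTime SI SII x₀ < ⊤}

/-- The critical angle. -/
noncomputable def criticalAngle (μ : Measure ℂ) [IsProbabilityMeasure μ] (ε : ℝ) : ℝ :=
  sSup (finiteAngles μ ε)

end TugOfWar

/-! The proof builds a Lyapunov function: a nonnegative function of the position whose mean drops by
at least a fixed `ω > 0` on every turn before the end, whatever player I does. Telescoping this drop
bounds the expected end time (`mul_expectedEndTime_le`).

The function comes from `u = r² ψ(θ)`, positive and strictly superharmonic for the normalized
`p`-Laplacian. For `q > p`, a `q`-harmonic function of this form is found by separation of variables
for `W = -ψ'/ψ`. It lives up to the half-angle `(π/2)(1 - √((q-1)/(2q)))`, and it is strictly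
`p`-superharmonic because `p < q` (`exists_slope`, `exists_profile`). Letting `q ↓ p` gives every
aperture below the stated bound.

The exponent enters through `1 + C₁₁ = (p-1) C₂₂`: averaged over the noise, a Hessian `H` in
direction `v` gives `C₂₂ ((p-1) H(v,v) + H(v⊥,v⊥))`. For `v` parallel to `∇u` this is `C₂₂ |v|²`
times the normalized `p`-Laplacian of `u`, hence negative.

Player II pulls with full strength against `∇u`. If player I pulls exactly the other way, the
first-order terms cancel and the negative second-order term remains. If I deviates by `d` from that
move, he loses at least `|∇u| d²/(2ε)` at first order and gains at most a multiple of `d` at second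
order, which is harmless once `|∇u|` is large (`mean_change_le`). Since `u` has degree two, its
gradient grows linearly and its Hessian depends on the angle only. So replacing `u(x)` by `u(x + L)`
with `L` large makes the gradient large and the Taylor error small on the whole wedge
(`exists_potential_add_le`). These facts meet in `mem_finiteAngles_of_profile`. -/

namespace TugOfWar

/-! ### The drift criterion for the expected end time -/

section
variable {μ : Measure ℂ} {D : Set ℂ} {ε : ℝ}

/-- The end time is at most the number of times at which the position is off the boundary. -/
theorem endTime_le_tsum (D : Set ℂ) (h : ℕ → ℂ × ℂ) :
    endTime D h ≤ ∑' n, (frontier D)ᶜ.indicator (fun _ => (1 : ℝ≥0∞)) (h n).2 := by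
  classical
  by_cases hex : ∃ k, (h k).2 ∈ frontier D
  · calc endTime D h ≤ (Nat.find hex : ℝ≥0∞) := iInf₂_le (f := fun (k : ℕ) (_ : (h k).2 ∈ frontier D) => (k : ℝ≥0∞)) _
          (Nat.find_spec hex)
      _ = ∑ n ∈ Finset.range (Nat.find hex),
          (frontier D)ᶜ.indicator (fun _ => (1 : ℝ≥0∞)) (h n).2 := by
        rw [Finset.sum_congr rfl (g := fun _ => (1 : ℝ≥0∞))]
        · simp
        · intro n hn
          exact Set.indicator_of_mem (Nat.find_min hex (Finset.mem_range.1 hn)) _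
      _ ≤ _ := ENNReal.sum_le_tsum _
  · push Not at hex
    have : ∀ n, (frontier D)ᶜ.indicator (fun _ => (1 : ℝ≥0∞)) (h n).2 = 1 := fun n =>
      Set.indicator_of_mem (hex n) _
    simp [this]

theorem lintegral_gameMeasure_position [IsProbabilityMeasure μ] (SI SII : Strategy μ D ε) (x₀ : ℂ)
    {f : ℂ → ℝ≥0∞} (hf : Measurable f) (n : ℕ) :
    ∫⁻ h, f (h n).2 ∂gameMeasure SI SII x₀ =
      ∫⁻ h : History n, f h.position ∂Kernel.partialTraj (X := fun _ => ℂ × ℂ)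
        (transition SI SII) 0 n (fun _ => (0, x₀)) := by
  rw [gameMeasure, ← Kernel.traj_map_frestrictLe_apply, lintegral_map]
  · rfl
  · exact hf.comp History.measurable_position
  · fun_prop

/-- Conditioning on the history up to `n`: its law followed by one transition is the law of the
history up to `n + 1`. -/
theorem lintegral_gameMeasure_position_succ [IsProbabilityMeasure μ] (SI SII : Strategy μ D ε)
    (x₀ : ℂ) {f : ℂ → ℝ≥0∞} (hf : Measurable f) (n : ℕ) :
    ∫⁻ h, f (h (n + 1)).2 ∂gameMeasure SI SII x₀ =
      ∫⁻ h : History n, ∫⁻ y, f y.2 ∂transition SI SII n h ∂Kernel.partialTraj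
        (X := fun _ => ℂ × ℂ) (transition SI SII) 0 n (fun _ => (0, x₀)) := by
  have h2 : Measurable fun q : History n × (ℂ × ℂ) => f q.2.2 :=
    hf.comp (measurable_snd.comp measurable_snd)
  rw [← Measure.lintegral_compProd (f := fun q : History n × (ℂ × ℂ) => f q.2.2) h2,
    Kernel.partialTraj_compProd_eq_map_traj (Nat.zero_le n), lintegral_map h2]
  · rfl
  · fun_prop

/-- Telescoping, stated additively because subtraction in `ℝ≥0∞` truncates. -/
theorem add_mul_sum_range_le {c : ℝ≥0∞}
    {b a : ℕ → ℝ≥0∞} (h : ∀ n, b (n + 1) + c * a n ≤ b n) (N : ℕ) :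
    b N + c * ∑ n ∈ Finset.range N, a n ≤ b 0 := by
  induction N with
  | zero => simp
  | succ N ih =>
    rw [Finset.sum_range_succ, mul_add, add_comm (c * _), ← add_assoc]
    exact (add_le_add_left (h N) _).trans ih

/-- A Lyapunov function for the game bounds the expected end time. -/
theorem mul_expectedEndTime_le [IsProbabilityMeasure μ] (SI SII : Strategy μ D ε)
    {Φ : ℂ → ℝ≥0∞} (hΦ : Measurable Φ) (c : ℝ≥0∞)
    (hstep : ∀ n (h : History n), ∫⁻ y, Φ y.2 ∂transition SI SII n h +
      c * (frontier D)ᶜ.indicator (fun _ => 1) h.position ≤ Φ h.position) (x₀ : ℂ) :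
    c * expectedEndTime SI SII x₀ ≤ Φ x₀ := by
  have hind : Measurable ((frontier D)ᶜ.indicator fun _ => (1 : ℝ≥0∞)) :=
    measurable_const.indicator isClosed_frontier.measurableSet.compl
  set P := gameMeasure SI SII x₀ with hP
  have hindp : ∀ n, Measurable fun h : History n =>
      (frontier D)ᶜ.indicator (fun _ => (1 : ℝ≥0∞)) h.position := fun n =>
    hind.comp History.measurable_position
  have hmeas : ∀ n : ℕ, Measurable fun h : ℕ → ℂ × ℂ =>
      (frontier D)ᶜ.indicator (fun _ => (1 : ℝ≥0∞)) (h n).2 := fun n =>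
    hind.comp (measurable_snd.comp (measurable_pi_apply n))
  have hb : ∀ n, ∫⁻ h, Φ (h (n + 1)).2 ∂P + c * ∫⁻ h, (frontier D)ᶜ.indicator (fun _ => 1) (h n).2 ∂P
      ≤ ∫⁻ h, Φ (h n).2 ∂P := by
    intro n
    rw [hP, lintegral_gameMeasure_position_succ SI SII x₀ hΦ,
      lintegral_gameMeasure_position SI SII x₀ hind, lintegral_gameMeasure_position SI SII x₀ hΦ,
      ← lintegral_const_mul _ (hindp n), ← lintegral_add_right]
    · exact lintegral_mono fun h => hstep n h
    · exact (hindp n).const_mul _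
  have h0 : ∫⁻ h, Φ (h 0).2 ∂P = Φ x₀ := by
    rw [hP, lintegral_gameMeasure_position SI SII x₀ hΦ, Kernel.partialTraj_self, Kernel.id_apply,
      lintegral_dirac' (f := fun h : History 0 => Φ h.position) _ (hΦ.comp History.measurable_position)]
    rfl
  calc c * expectedEndTime SI SII x₀
      ≤ c * ∫⁻ h, ∑' n, (frontier D)ᶜ.indicator (fun _ => 1) (h n).2 ∂P := by
        exact mul_le_mul_right (lintegral_mono fun h => endTime_le_tsum D h) c
    _ = c * ∑' n, ∫⁻ h, (frontier D)ᶜ.indicator (fun _ => 1) (h n).2 ∂P := by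
        rw [lintegral_tsum fun n => (hmeas n).aemeasurable]
    _ = ⨆ N : ℕ, c * ∑ n ∈ Finset.range N, ∫⁻ h, (frontier D)ᶜ.indicator (fun _ => 1) (h n).2 ∂P := by
        rw [ENNReal.tsum_eq_iSup_nat, ENNReal.mul_iSup]
    _ ≤ Φ x₀ := by
        refine iSup_le fun N => ?_
        rw [← h0]
        exact le_add_self.trans (add_mul_sum_range_le (b := fun n => ∫⁻ h, Φ (h n).2 ∂P) hb N)

end

/-! ### The angular profile of a strictly superharmonic function of degree two -/

open Filter Topology in
/-- The logarithmic derivative, up to sign, of the angular part of the homogeneous `q`-harmonic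
function of degree two. -/
theorem exists_slope {q : ℝ} (hq : 1 < q) :
    ∃ W : ℝ → ℝ, ∀ θ, |θ| < Real.pi / 2 * (1 - Real.sqrt ((q - 1) / (2 * q))) →
      HasDerivAt W ((4 + W θ ^ 2) * (2 * q + (q - 1) * W θ ^ 2) / (4 + (q - 1) * W θ ^ 2)) θ := by
  set k := Real.sqrt ((q - 1) / (2 * q)) with hk
  have hk2 : k ^ 2 = (q - 1) / (2 * q) := Real.sq_sqrt (by apply div_nonneg <;> linarith)
  have hk0 : 0 < k := Real.sqrt_pos.2 (by apply div_pos <;> linarith)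
  -- Separation of variables in `W' = F(W)`: partial fractions give `1/F = 2/(4+w²) - k²/(1+k²w²)`,
  -- whose antiderivative is `g`. Thus `W` is the inverse of `g`.
  let g : ℝ → ℝ := fun w => Real.arctan (w / 2) - k * Real.arctan (k * w)
  let F : ℝ → ℝ := fun w => (4 + w ^ 2) * (2 * q + (q - 1) * w ^ 2) / (4 + (q - 1) * w ^ 2)
  have hFpos : ∀ w, 0 < F w := by
    intro w
    have h1 : 0 ≤ (q - 1) * w ^ 2 := mul_nonneg (by linarith) (sq_nonneg w)
    have : 0 < 4 + w ^ 2 := by positivity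
    simp only [F]
    apply div_pos (mul_pos this (by linarith)) (by linarith)
  have hg : ∀ w, HasDerivAt g (F w)⁻¹ w := by
    intro w
    have h1 : 0 ≤ (q - 1) * w ^ 2 := mul_nonneg (by linarith) (sq_nonneg w)
    have hd := ((hasDerivAt_id w).div_const 2).arctan.sub
      (((hasDerivAt_id w).const_mul k).arctan.const_mul k)
    refine hd.congr_deriv ?_
    have e1 : k * (1 / (1 + (k * id w) ^ 2) * (k * 1)) = k ^ 2 / (1 + k ^ 2 * w ^ 2) := by
      simp only [id, mul_pow]; ring
    rw [e1, hk2]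
    simp only [F, id]
    have h3 : 4 + (q - 1) * w ^ 2 ≠ 0 := by linarith
    have h4 : 2 * q + (q - 1) * w ^ 2 ≠ 0 := by linarith
    have h5 : 1 + (q - 1) / (2 * q) * w ^ 2 ≠ 0 := by
      have : 0 ≤ (q - 1) / (2 * q) := div_nonneg (by linarith) (by linarith)
      positivity
    have h6 : (q - 1) / (2 * q) / (1 + (q - 1) / (2 * q) * w ^ 2) =
        (q - 1) / (2 * q + (q - 1) * w ^ 2) := by
      have : (2 * q) ≠ 0 := by linarith
      rw [div_eq_div_iff h5 h4]
      field_simp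
    rw [h6, inv_div]
    have h7 : (1 + (w / 2) ^ 2) = (4 + w ^ 2) / 4 := by ring
    have h8 : 4 + w ^ 2 ≠ 0 := by positivity
    rw [h7]
    obtain ⟨B, hB⟩ : ∃ B, B = 2 * q + (q - 1) * w ^ 2 := ⟨_, rfl⟩
    rw [← hB] at h4 ⊢
    field_simp
    rw [hB]
    ring
  have hmono : StrictMono g := strictMono_of_deriv_pos fun w => by
    rw [(hg w).deriv]
    exact inv_pos.2 (hFpos w)
  have hcont : Continuous g := continuous_iff_continuousAt.2 fun w => (hg w).continuousAt
  have hodd : ∀ w, g (-w) = -g w := fun w => by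
    simp only [g]
    rw [neg_div, mul_neg, Real.arctan_neg, Real.arctan_neg]
    ring
  -- The asymptotes of the two arctangents give the limiting half-angle, where `W` blows up.
  have hlim : Tendsto g atTop (𝓝 (Real.pi / 2 * (1 - k))) := by
    have ha : Tendsto Real.arctan atTop (𝓝 (Real.pi / 2)) :=
      Real.tendsto_arctan_atTop.mono_right nhdsWithin_le_nhds
    have h1 := ha.comp (tendsto_id.atTop_div_const (show (0 : ℝ) < 2 by norm_num))
    have h2 := (ha.comp (tendsto_id.const_mul_atTop hk0)).const_mul k
    rw [show Real.pi / 2 * (1 - k) = Real.pi / 2 - k * (Real.pi / 2) by ring]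
    exact h1.sub h2
  have hrange : ∀ θ, |θ| < Real.pi / 2 * (1 - k) → Set.range g ∈ 𝓝 θ := by
    intro θ hθ
    obtain ⟨w, hw⟩ := (hlim.eventually (lt_mem_nhds hθ)).exists
    have : Set.Ioo (-g w) (g w) ∈ 𝓝 θ := Ioo_mem_nhds (abs_lt.1 hw).1 (abs_lt.1 hw).2
    refine mem_of_superset this fun y hy => ?_
    exact mem_range_of_exists_le_of_exists_ge hcont ⟨-w, by rw [hodd]; exact hy.1.le⟩ ⟨w, hy.2.le⟩
  -- Outside the range of `g` the value of `invFun` is arbitrary; this is harmless, since the range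
  -- is a neighbourhood of each `θ` considered.
  refine ⟨Function.invFun g, fun θ hθ => ?_⟩
  have hleft : ∀ w, Function.invFun g (g w) = w := Function.leftInverse_invFun hmono.injective
  have hright : ∀ y ∈ Set.range g, g (Function.invFun g y) = y := by
    rintro _ ⟨w, rfl⟩
    rw [hleft]
  have hWmono : StrictMonoOn (Function.invFun g) (Set.range g) := by
    rintro _ ⟨a, rfl⟩ _ ⟨b, rfl⟩ hab
    rw [hleft, hleft]
    exact hmono.lt_iff_lt.1 hab
  have himg : Function.invFun g '' Set.range g = Set.univ := by
    ext w
    simp only [Set.mem_univ, iff_true]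
    exact ⟨g w, ⟨w, rfl⟩, hleft w⟩
  have hWcont : ContinuousAt (Function.invFun g) θ :=
    hWmono.continuousAt_of_image_mem_nhds (hrange θ hθ) (by rw [himg]; exact univ_mem)
  have := HasDerivAt.of_local_left_inverse hWcont (hg _) (inv_ne_zero (hFpos _).ne')
    (mem_of_superset (hrange θ hθ) hright)
  rwa [inv_inv] at this

/-- The angular part of a homogeneous function `r ^ 2 * ψ θ` whose normalized `p`-Laplacian is
negative. -/
theorem exists_profile {p q : ℝ} (hp : 1 < p) (hq : p < q) :
    ∃ ψ ψ₁ ψ₂ : ℝ → ℝ, ∀ θ, |θ| < Real.pi / 2 * (1 - Real.sqrt ((q - 1) / (2 * q))) →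
      HasDerivAt ψ (ψ₁ θ) θ ∧ HasDerivAt ψ₁ (ψ₂ θ) θ ∧ ContinuousAt ψ₂ θ ∧ 0 < ψ θ ∧
      p * (4 * ψ θ ^ 2 + ψ₁ θ ^ 2) * (4 * ψ θ + ψ₂ θ) -
        (p - 2) * (ψ₂ θ * (4 * ψ θ ^ 2 - ψ₁ θ ^ 2) - 8 * ψ θ * ψ₁ θ ^ 2) < 0 := by
  obtain ⟨W, hW⟩ := exists_slope (hp.trans hq)
  let F : ℝ → ℝ := fun w => (4 + w ^ 2) * (2 * q + (q - 1) * w ^ 2) / (4 + (q - 1) * w ^ 2)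
  -- An explicit solution of `ψ' = -Wψ`, found by integrating `-w / F(w)` in the variable `w = W θ`.
  let ψ : ℝ → ℝ := fun θ => Real.sqrt (2 * q + (q - 1) * W θ ^ 2) / (4 + W θ ^ 2)
  have hpos : ∀ θ, 0 < 2 * q + (q - 1) * W θ ^ 2 := fun θ => by
    have h1 : 0 ≤ (q - 1) * W θ ^ 2 := mul_nonneg (by linarith) (sq_nonneg _)
    linarith
  have hpos' : ∀ θ, 0 < 4 + (q - 1) * W θ ^ 2 := fun θ => by
    have h1 : 0 ≤ (q - 1) * W θ ^ 2 := mul_nonneg (by linarith) (sq_nonneg _)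
    linarith
  have hψ0 : ∀ θ, 0 < ψ θ := fun θ => div_pos (Real.sqrt_pos.2 (hpos θ)) (by positivity)
  refine ⟨ψ, fun θ => -W θ * ψ θ, fun θ => (W θ ^ 2 - F (W θ)) * ψ θ, fun θ hθ => ?_⟩
  have hWθ := hW θ hθ
  have hψ : HasDerivAt ψ (-W θ * ψ θ) θ := by
    have h1 := ((((hWθ.pow 2).const_mul (q - 1)).const_add (2 * q)).sqrt (hpos θ).ne').div
      ((hWθ.pow 2).const_add 4)
      (show 4 + W θ ^ 2 ≠ 0 by positivity)
    refine h1.congr_deriv ?_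
    have hs := Real.sq_sqrt (hpos θ).le
    have hs0 := Real.sqrt_pos.2 (hpos θ)
    simp only [ψ, Pi.pow_apply]
    set s := Real.sqrt (2 * q + (q - 1) * W θ ^ 2)
    have h3 := hpos' θ
    have h4 : 0 < 4 + W θ ^ 2 := by positivity
    rw [← hs]
    field_simp
    push_cast
    simp only [pow_one]
    linear_combination (-4 * W θ) * hs
  have hF : ContinuousAt (fun θ => F (W θ)) θ := by
    have := hWθ.continuousAt
    have h3 := (hpos' θ).ne'
    fun_prop (disch := exact h3)
  refine ⟨hψ, ?_, ?_, hψ0 θ, ?_⟩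
  · refine (hWθ.neg.mul hψ).congr_deriv ?_
    simp only [F, Pi.neg_apply]
    ring
  · exact ((hWθ.continuousAt.pow 2).sub hF).mul hψ.continuousAt
  · have hF' : F (W θ) * (4 + (q - 1) * W θ ^ 2) = (4 + W θ ^ 2) * (2 * q + (q - 1) * W θ ^ 2) :=
      div_mul_cancel₀ _ (hpos' θ).ne'
    set w := W θ
    have h4 : 0 < 4 + (q - 1) * w ^ 2 := hpos' θ
    -- Up to the factor `2ψ³`, this is the required expression in terms of `w`. It would vanish for
    -- `p = q`; the gap `q - p` makes it negative.
    have key : (4 + w ^ 2) * (2 * p + (p - 1) * w ^ 2) - F w * (4 + (p - 1) * w ^ 2) < 0 := by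
      have : ((4 + w ^ 2) * (2 * p + (p - 1) * w ^ 2) - F w * (4 + (p - 1) * w ^ 2)) *
          (4 + (q - 1) * w ^ 2) = -((4 + w ^ 2) * ((q - p) * (8 + 2 * w ^ 2))) := by
        linear_combination (-(4 + (p - 1) * w ^ 2)) * hF'
      have h5 : 0 < (4 + w ^ 2) * ((q - p) * (8 + 2 * w ^ 2)) := by
        have : 0 < q - p := by linarith
        positivity
      by_contra! hcon
      have := mul_nonneg hcon h4.le
      linarith
    have hψ3 : 0 < ψ θ ^ 3 := pow_pos (hψ0 θ) 3
    have := mul_neg_of_pos_of_neg hψ3 key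
    linarith [show p * (4 * ψ θ ^ 2 + (-w * ψ θ) ^ 2) * (4 * ψ θ + (w ^ 2 - F w) * ψ θ) -
        (p - 2) * ((w ^ 2 - F w) * ψ θ * (4 * ψ θ ^ 2 - (-w * ψ θ) ^ 2) -
          8 * ψ θ * (-w * ψ θ) ^ 2) = 2 * (ψ θ ^ 3 * ((4 + w ^ 2) * (2 * p + (p - 1) * w ^ 2) -
          F w * (4 + (p - 1) * w ^ 2))) by ring]

/-! ### Geometry of the convex wedge -/

/-- The signed distance to the complement of the wedge of half-aperture `γ < π / 2`. -/
noncomputable def depth (γ : ℝ) (z : ℂ) : ℝ :=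
  Real.sin γ * z.re - Real.cos γ * |z.im|

theorem continuous_depth (γ : ℝ) : Continuous (depth γ) := by
  unfold depth
  fun_prop

/-- Below aperture `π` the wedge is the intersection of two half-planes. Their linear forms at `z`
are `‖z‖ sin(η/2 ∓ arg z)`, and `depth` is the smaller of the two. -/
theorem mem_wedge_iff_depth_pos {η : ℝ} (h0 : 0 < η) (hπ : η < Real.pi) (z : ℂ) :
    z ∈ wedge η ↔ 0 < depth (η / 2) z := by
  have hs : 0 < Real.sin (η / 2) := Real.sin_pos_of_pos_of_lt_pi (by linarith) (by linarith)
  have hc : 0 < Real.cos (η / 2) := Real.cos_pos_of_mem_Ioo ⟨by linarith, by linarith⟩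
  have hre : z.re = ‖z‖ * Real.cos z.arg := (Complex.norm_mul_cos_arg z).symm
  have him : z.im = ‖z‖ * Real.sin z.arg := (Complex.norm_mul_sin_arg z).symm
  have e1 : Real.sin (η / 2) * z.re - Real.cos (η / 2) * z.im = ‖z‖ * Real.sin (η / 2 - z.arg) := by
    rw [hre, him, Real.sin_sub]; ring
  have e2 : Real.sin (η / 2) * z.re + Real.cos (η / 2) * z.im = ‖z‖ * Real.sin (η / 2 + z.arg) := by
    rw [hre, him, Real.sin_add]; ring
  have key : 0 < depth (η / 2) z ↔ 0 < Real.sin (η / 2) * z.re - Real.cos (η / 2) * z.im ∧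
      0 < Real.sin (η / 2) * z.re + Real.cos (η / 2) * z.im := by
    rw [depth]
    rcases abs_cases z.im with ⟨h, h'⟩ | ⟨h, h'⟩ <;> rw [h] <;> constructor
    · intro h2
      exact ⟨h2, by nlinarith⟩
    · exact fun h2 => h2.1
    · intro h2
      exact ⟨by nlinarith, by linarith⟩
    · intro h2
      linarith [h2.2]
  rw [key]
  constructor
  · rintro ⟨hz, h1, h2⟩
    have hz' : 0 < ‖z‖ := norm_pos_iff.2 hz
    rw [e1, e2]
    exact ⟨mul_pos hz' (Real.sin_pos_of_pos_of_lt_pi (by linarith) (by linarith)),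
      mul_pos hz' (Real.sin_pos_of_pos_of_lt_pi (by linarith) (by linarith))⟩
  · rintro ⟨h1, h2⟩
    have hzre : 0 < z.re := pos_of_mul_pos_right (a := Real.sin (η / 2)) (by linarith) hs.le
    have hz : z ≠ 0 := by
      rintro rfl
      simp at hzre
    have hz' : 0 < ‖z‖ := norm_pos_iff.2 hz
    have ha := abs_lt.1 (Complex.abs_arg_lt_pi_div_two_iff.2 (Or.inl hzre))
    rw [e1] at h1
    rw [e2] at h2
    have h1' := pos_of_mul_pos_right h1 hz'.le
    have h2' := pos_of_mul_pos_right h2 hz'.le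
    refine ⟨hz, ?_, ?_⟩
    · by_contra! hcon
      linarith [Real.sin_nonpos_of_nonpos_of_neg_pi_le
        (show η / 2 + z.arg ≤ 0 by linarith) (by linarith)]
    · by_contra! hcon
      linarith [Real.sin_nonpos_of_nonpos_of_neg_pi_le
        (show η / 2 - z.arg ≤ 0 by linarith) (by linarith)]

/-- Cauchy–Schwarz with the unit vector `(sin γ, cos γ)`. -/
theorem depth_sub_depth_le {γ : ℝ} (hs : 0 ≤ Real.sin γ) (hc : 0 ≤ Real.cos γ) (x y : ℂ) :
    depth γ x - depth γ y ≤ ‖x - y‖ := by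
  have h1 : |y.im| - |x.im| ≤ |(x - y).im| := by
    rw [Complex.sub_im, abs_sub_comm]
    exact abs_sub_abs_le_abs_sub _ _
  have h2 : x.re - y.re ≤ |(x - y).re| := by
    rw [Complex.sub_re]
    exact le_abs_self _
  calc depth γ x - depth γ y = Real.sin γ * (x.re - y.re) + Real.cos γ * (|y.im| - |x.im|) := by
        rw [depth, depth]; ring
    _ ≤ Real.sin γ * |(x - y).re| + Real.cos γ * |(x - y).im| := by gcongr
    _ ≤ ‖x - y‖ := by
        rw [Complex.norm_eq_sqrt_sq_add_sq]
        apply Real.le_sqrt_of_sq_le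
        have := Real.sin_sq_add_cos_sq γ
        rw [← sq_abs (x - y).re, ← sq_abs (x - y).im]
        set a := |(x - y).re|
        set b := |(x - y).im|
        nlinarith [sq_nonneg (Real.sin γ * b - Real.cos γ * a)]

theorem depth_add_ofReal (γ : ℝ) (x : ℂ) (L : ℝ) :
    depth γ (x + L) = depth γ x + Real.sin γ * L := by
  simp only [depth, Complex.add_re, Complex.ofReal_re, Complex.add_im, Complex.ofReal_im, add_zero]
  ring

/-- The point of the boundary of the wedge of half-aperture `γ` nearest to a point of the wedge. -/
noncomputable def sideProj (γ : ℝ) (z : ℂ) : ℂ :=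
  if 0 ≤ z.im then
    ((Real.cos γ * z.re + Real.sin γ * z.im : ℝ) : ℂ) * ⟨Real.cos γ, Real.sin γ⟩
  else ((Real.cos γ * z.re - Real.sin γ * z.im : ℝ) : ℂ) * ⟨Real.cos γ, -Real.sin γ⟩

theorem measurable_sideProj (γ : ℝ) : Measurable (sideProj γ) := by
  unfold sideProj
  refine Measurable.ite (measurableSet_le measurable_const Complex.measurable_im) ?_ ?_ <;>
    fun_prop

theorem dist_sideProj {γ : ℝ} {z : ℂ} (hz : 0 ≤ depth γ z) : dist (sideProj γ z) z = depth γ z := by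
  have hsc := Real.sin_sq_add_cos_sq γ
  rw [dist_eq_norm, Complex.norm_eq_sqrt_sq_add_sq, Real.sqrt_eq_iff_eq_sq (by positivity) hz, sideProj,
    depth]
  split_ifs with h
  · rw [abs_of_nonneg h]
    simp only [Complex.sub_re, Complex.sub_im, Complex.re_ofReal_mul, Complex.im_ofReal_mul]
    have h1 : (Real.cos γ * z.re + Real.sin γ * z.im) * Real.cos γ - z.re =
        -Real.sin γ * (Real.sin γ * z.re - Real.cos γ * z.im) := by
      linear_combination z.re * hsc
    have h2 : (Real.cos γ * z.re + Real.sin γ * z.im) * Real.sin γ - z.im =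
        Real.cos γ * (Real.sin γ * z.re - Real.cos γ * z.im) := by
      linear_combination z.im * hsc
    rw [h1, h2]
    linear_combination (Real.sin γ * z.re - Real.cos γ * z.im) ^ 2 * hsc
  · rw [abs_of_neg (not_le.1 h)]
    simp only [Complex.sub_re, Complex.sub_im, Complex.re_ofReal_mul, Complex.im_ofReal_mul]
    have h1 : (Real.cos γ * z.re - Real.sin γ * z.im) * Real.cos γ - z.re =
        -Real.sin γ * (Real.sin γ * z.re + Real.cos γ * z.im) := by
      linear_combination z.re * hsc
    have h2 : (Real.cos γ * z.re - Real.sin γ * z.im) * -Real.sin γ - z.im =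
        -Real.cos γ * (Real.sin γ * z.re + Real.cos γ * z.im) := by
      linear_combination z.im * hsc
    rw [h1, h2]
    linear_combination (Real.sin γ * z.re + Real.cos γ * z.im) ^ 2 * hsc

section
variable {η : ℝ}

theorem isOpen_wedge (h0 : 0 < η) (hπ : η < Real.pi) : IsOpen (wedge η) := by
  have : wedge η = {z | 0 < depth (η / 2) z} := Set.ext (mem_wedge_iff_depth_pos h0 hπ)
  rw [this]
  exact isOpen_lt continuous_const (continuous_depth _)

theorem sin_half_pos (h0 : 0 < η) (hπ : η < Real.pi) : 0 < Real.sin (η / 2) :=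
  Real.sin_pos_of_pos_of_lt_pi (by linarith) (by linarith)

theorem cos_half_pos (h0 : 0 < η) (hπ : η < Real.pi) : 0 < Real.cos (η / 2) :=
  Real.cos_pos_of_mem_Ioo ⟨by linarith, by linarith⟩

theorem re_pos_of_depth_pos {γ : ℝ} (hs : 0 < Real.sin γ) (hc : 0 ≤ Real.cos γ) {z : ℂ}
    (hz : 0 < depth γ z) : 0 < z.re := by
  have := mul_nonneg hc (abs_nonneg z.im)
  rw [depth] at hz
  exact pos_of_mul_pos_right (a := Real.sin γ) (by linarith) hs.le

theorem mem_frontier_wedge_of_depth_eq_zero (h0 : 0 < η) (hπ : η < Real.pi) {z : ℂ}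
    (hz : depth (η / 2) z = 0) : z ∈ frontier (wedge η) := by
  rw [(isOpen_wedge h0 hπ).frontier_eq]
  refine ⟨?_, fun h => ((mem_wedge_iff_depth_pos h0 hπ z).1 h).ne' hz⟩
  have hlim : Filter.Tendsto (fun t : ℝ => z + t) (nhdsWithin 0 (Set.Ioi 0)) (nhds z) := by
    have : Continuous fun t : ℝ => z + t := by fun_prop
    have := this.tendsto 0
    simp only [Complex.ofReal_zero, add_zero] at this
    exact this.mono_left nhdsWithin_le_nhds
  refine mem_closure_of_tendsto hlim ?_
  filter_upwards [self_mem_nhdsWithin] with t ht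
  rw [mem_wedge_iff_depth_pos h0 hπ, depth_add_ofReal, hz, zero_add]
  exact mul_pos (sin_half_pos h0 hπ) ht

theorem sideProj_mem_frontier (h0 : 0 < η) (hπ : η < Real.pi) {z : ℂ} (hz : z ∈ wedge η) :
    sideProj (η / 2) z ∈ frontier (wedge η) := by
  apply mem_frontier_wedge_of_depth_eq_zero h0 hπ
  have hs := sin_half_pos h0 hπ
  have hc := cos_half_pos h0 hπ
  have hre := re_pos_of_depth_pos hs hc.le ((mem_wedge_iff_depth_pos h0 hπ z).1 hz)
  have hcr := mul_pos hc hre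
  rw [sideProj]
  split_ifs with h
  · have : 0 ≤ Real.cos (η / 2) * z.re + Real.sin (η / 2) * z.im := by
      have := mul_nonneg hs.le h
      linarith
    simp only [depth, Complex.re_ofReal_mul, Complex.im_ofReal_mul, abs_mul, abs_of_nonneg this,
      abs_of_pos hs]
    ring
  · have : 0 ≤ Real.cos (η / 2) * z.re - Real.sin (η / 2) * z.im := by
      have := mul_neg_of_pos_of_neg hs (not_le.1 h)
      linarith
    simp only [depth, Complex.re_ofReal_mul, Complex.im_ofReal_mul, abs_mul, abs_of_nonneg this,
      abs_neg, abs_of_pos hs]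
    ring

/-- The projection to a side attains the value; no boundary point is nearer, since `depth` is
1-Lipschitz and nonpositive off the open wedge. -/
theorem infDist_frontier_wedge (h0 : 0 < η) (hπ : η < Real.pi) {z : ℂ} (hz : z ∈ wedge η) :
    Metric.infDist z (frontier (wedge η)) = depth (η / 2) z := by
  have hd := (mem_wedge_iff_depth_pos h0 hπ z).1 hz
  have hmem := sideProj_mem_frontier h0 hπ hz
  apply le_antisymm
  · rw [← dist_sideProj hd.le, dist_comm]
    exact Metric.infDist_le_dist_of_mem hmem
  · refine (Metric.le_infDist ⟨_, hmem⟩).2 fun y hy => ?_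
    rw [(isOpen_wedge h0 hπ).frontier_eq] at hy
    have h1 := mt (mem_wedge_iff_depth_pos h0 hπ y).2 hy.2
    have h2 := depth_sub_depth_le (sin_half_pos h0 hπ).le (cos_half_pos h0 hπ).le z y
    rw [dist_eq_norm]
    linarith [not_lt.1 h1]

theorem add_mem_wedge_of_norm_lt_infDist (h0 : 0 < η) (hπ : η < Real.pi) {z h : ℂ}
    (hz : z ∈ wedge η) (hh : ‖h‖ < Metric.infDist z (frontier (wedge η))) : z + h ∈ wedge η := by
  rw [infDist_frontier_wedge h0 hπ hz] at hh
  rw [mem_wedge_iff_depth_pos h0 hπ]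
  have := depth_sub_depth_le (sin_half_pos h0 hπ).le (cos_half_pos h0 hπ).le z (z + h)
  rw [sub_add_cancel_left, norm_neg] at this
  linarith

theorem add_ofReal_mem_wedge (h0 : 0 < η) (hπ : η < Real.pi) {z : ℂ} (hz : z ∈ wedge η) {L : ℝ}
    (hL : 0 ≤ L) : z + L ∈ wedge η := by
  rw [mem_wedge_iff_depth_pos h0 hπ] at hz ⊢
  rw [depth_add_ofReal]
  have := mul_nonneg (sin_half_pos h0 hπ).le hL
  linarith

theorem re_pos_of_mem_wedge (h0 : 0 < η) (hπ : η < Real.pi) {z : ℂ} (hz : z ∈ wedge η) :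
    0 < z.re :=
  re_pos_of_depth_pos (sin_half_pos h0 hπ) (cos_half_pos h0 hπ).le
    ((mem_wedge_iff_depth_pos h0 hπ z).1 hz)

end

/-! ### Derivatives and Taylor expansion of the potential -/

open scoped ComplexConjugate

/-- The homogeneous function `r ^ 2 * ψ θ` of degree two. -/
noncomputable def potential (ψ : ℝ → ℝ) (z : ℂ) : ℝ :=
  Complex.normSq z * ψ z.arg

/-- The gradient of `r ^ 2 * ψ θ`, where `ψ₁` is the derivative of `ψ`. -/
noncomputable def potentialGrad (ψ ψ₁ : ℝ → ℝ) (z : ℂ) : ℂ :=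
  z * (⟨2 * ψ z.arg, ψ₁ z.arg⟩ : ℂ)

/-- The Hessian of `r ^ 2 * ψ θ` in the direction `h`, where `ψ₁` and `ψ₂` are the derivatives
of `ψ`. -/
noncomputable def hess (ψ ψ₁ ψ₂ : ℝ → ℝ) (θ : ℝ) (h : ℂ) : ℝ :=
  ((4 * ψ θ + ψ₂ θ) * Complex.normSq h -
    ((⟨ψ₂ θ, 2 * ψ₁ θ⟩ : ℂ) * Complex.exp (-(2 * θ * Complex.I)) * h ^ 2).re) / 2

section
variable {ψ ψ₁ ψ₂ : ℝ → ℝ}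

/-- The argument is the imaginary part of the logarithm. -/
theorem hasDerivAt_arg_curve {c : ℝ → ℂ} {h : ℂ} {s : ℝ} (hc : HasDerivAt c h s)
    (hs : c s ∈ Complex.slitPlane) :
    HasDerivAt (fun t => (c t).arg) (h / c s).im s := by
  have := Complex.imCLM.hasFDerivAt.comp_hasDerivAt s (hc.clog_real hs)
  simpa [Function.comp_def, Complex.log_im] using! this

theorem hasDerivAt_re_conj_mul {c : ℝ → ℂ} {h : ℂ} {s : ℝ} (hc : HasDerivAt c h s) (w : ℂ) :
    HasDerivAt (fun t => (conj (c t) * w).re) (conj h * w).re s := by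
  have h1 := (Complex.reCLM.hasFDerivAt.comp_hasDerivAt s hc).mul_const w.re
  have h2 := (Complex.imCLM.hasFDerivAt.comp_hasDerivAt s hc).mul_const w.im
  simpa [Function.comp_def, Complex.mul_re] using! h1.add h2

theorem hasDerivAt_im_conj_mul {c : ℝ → ℂ} {h : ℂ} {s : ℝ} (hc : HasDerivAt c h s) (w : ℂ) :
    HasDerivAt (fun t => (conj (c t) * w).im) (conj h * w).im s := by
  have h1 := (Complex.reCLM.hasFDerivAt.comp_hasDerivAt s hc).mul_const w.im
  have h2 := (Complex.imCLM.hasFDerivAt.comp_hasDerivAt s hc).mul_const w.re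
  simpa [Function.comp_def, Complex.mul_im, sub_eq_add_neg] using! h1.sub h2

theorem hasDerivAt_normSq_curve {c : ℝ → ℂ} {h : ℂ} {s : ℝ} (hc : HasDerivAt c h s) :
    HasDerivAt (fun t => Complex.normSq (c t)) (2 * (conj (c s) * h).re) s := by
  have h1 := (Complex.reCLM.hasFDerivAt.comp_hasDerivAt s hc)
  have h2 := (Complex.imCLM.hasFDerivAt.comp_hasDerivAt s hc)
  have := (h1.mul h1).add (h2.mul h2)
  refine (this.congr_deriv ?_)
  simp [Complex.mul_re]
  ring

theorem re_mul_conj_potentialGrad (z h : ℂ) :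
    (h * conj (potentialGrad ψ ψ₁ z)).re =
      2 * ψ z.arg * (conj z * h).re + ψ₁ z.arg * (conj z * h).im := by
  simp [potentialGrad, Complex.mul_re, Complex.mul_im]
  ring

theorem hasDerivAt_potential_curve {c : ℝ → ℂ} {h : ℂ} {s : ℝ} (hc : HasDerivAt c h s)
    (hs : c s ∈ Complex.slitPlane) (hψ : HasDerivAt ψ (ψ₁ (c s).arg) (c s).arg) :
    HasDerivAt (fun t => potential ψ (c t)) (h * conj (potentialGrad ψ ψ₁ (c s))).re s := by
  have h0 : Complex.normSq (c s) ≠ 0 := by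
    simpa using Complex.slitPlane_ne_zero hs
  refine ((hasDerivAt_normSq_curve hc).mul
    (hψ.comp s (hasDerivAt_arg_curve hc hs))).congr_deriv ?_
  rw [re_mul_conj_potentialGrad]
  have : (h / c s).im = (conj (c s) * h).im / Complex.normSq (c s) := by
    rw [div_eq_mul_inv, Complex.inv_def, mul_left_comm, ← mul_assoc,
      Complex.im_mul_ofReal, div_eq_mul_inv]
  simp only [Function.comp_apply]
  rw [this]
  field_simp

theorem hasDerivAt_re_mul_conj_potentialGrad {c : ℝ → ℂ} {h : ℂ} {s : ℝ} (hc : HasDerivAt c h s)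
    (hs : c s ∈ Complex.slitPlane) (hψ : HasDerivAt ψ (ψ₁ (c s).arg) (c s).arg)
    (hψ₁ : HasDerivAt ψ₁ (ψ₂ (c s).arg) (c s).arg) :
    HasDerivAt (fun t => (h * conj (potentialGrad ψ ψ₁ (c t))).re)
      (hess ψ ψ₁ ψ₂ (c s).arg h) s := by
  have ha := hasDerivAt_arg_curve hc hs
  have hd := (((hψ.comp s ha).const_mul 2).mul (hasDerivAt_re_conj_mul hc h)).add
    ((hψ₁.comp s ha).mul (hasDerivAt_im_conj_mul hc h))
  have hfun : (fun t => (h * conj (potentialGrad ψ ψ₁ (c t))).re) = fun t =>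
      2 * ψ (c t).arg * (conj (c t) * h).re + ψ₁ (c t).arg * (conj (c t) * h).im :=
    funext fun t => re_mul_conj_potentialGrad _ _
  rw [hfun]
  refine hd.congr_deriv ?_
  set θ := (c s).arg with hθ
  set e := Complex.exp (θ * Complex.I) with he
  have hr0 : ‖c s‖ ≠ 0 := norm_ne_zero_iff.2 (Complex.slitPlane_ne_zero hs)
  have hce : c s = ‖c s‖ * e := (Complex.norm_mul_exp_arg_mul_I (c s)).symm
  set r := ‖c s‖
  have hee : conj e * e = 1 := by
    rw [← Complex.normSq_eq_conj_mul_self, Complex.normSq_eq_norm_sq, he,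
      Complex.norm_exp_ofReal_mul_I]
    simp
  have he0 : e ≠ 0 := Complex.exp_ne_zero _
  -- The components of `k` are those of `h` in the radial and angular frame at `c s`. In this frame
  -- the radius cancels.
  obtain ⟨k, hk⟩ : ∃ k, h = k * e := ⟨h / e, (div_mul_cancel₀ _ he0).symm⟩
  have e1 : conj (c s) * h = r * k := by
    rw [hce, hk, map_mul, Complex.conj_ofReal]
    linear_combination (r * k : ℂ) * hee
  have e2 : h / c s = k / r := by
    have : (r : ℂ) ≠ 0 := by exact_mod_cast hr0
    rw [hce, hk]
    field_simp
  have e3 : Complex.exp (-(2 * θ * Complex.I)) * h ^ 2 = k ^ 2 := by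
    have : Complex.exp (-(2 * θ * Complex.I)) * e ^ 2 = 1 := by
      rw [he, ← Complex.exp_nat_mul, ← Complex.exp_add]
      convert Complex.exp_zero using 2
      push_cast
      ring
    rw [hk]
    linear_combination k ^ 2 * this
  have e4 : Complex.normSq h = Complex.normSq k := by
    have : Complex.normSq e = 1 := by
      have := Complex.normSq_eq_conj_mul_self (z := e)
      rw [hee] at this
      exact_mod_cast this
    rw [hk, Complex.normSq_mul, this, mul_one]
  have e5 : conj h * h = (Complex.normSq k : ℂ) := by
    rw [← Complex.normSq_eq_conj_mul_self, e4]
  have hsq : (k ^ 2).re = k.re ^ 2 - k.im ^ 2 ∧ (k ^ 2).im = 2 * k.re * k.im := by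
    rw [sq, Complex.mul_re, Complex.mul_im]
    constructor <;> ring
  rw [hess, mul_assoc (⟨_, _⟩ : ℂ), e3, e4]
  simp only [Function.comp_apply]
  rw [e1, e2, e5]
  rw [Complex.mul_re _ (k ^ 2), hsq.1, hsq.2, Complex.normSq_apply]
  simp only [Complex.re_ofReal_mul, Complex.im_ofReal_mul, Complex.ofReal_re, Complex.ofReal_im,
    Complex.div_ofReal_im, ← hθ]
  field_simp
  ring

/-- A second-order Taylor upper bound. -/
theorem image_one_le_of_second_deriv_le {φ φ₁ φ₂ : ℝ → ℝ} {B : ℝ}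
    (h1 : ∀ s ∈ Set.Icc (0 : ℝ) 1, HasDerivAt φ (φ₁ s) s)
    (h2 : ∀ s ∈ Set.Icc (0 : ℝ) 1, HasDerivAt φ₁ (φ₂ s) s)
    (hB : ∀ s ∈ Set.Icc (0 : ℝ) 1, φ₂ s ≤ B) : φ 1 ≤ φ 0 + φ₁ 0 + B / 2 := by
  have anti : ∀ {f f' : ℝ → ℝ}, (∀ s ∈ Set.Icc (0 : ℝ) 1, HasDerivAt f (f' s) s) →
      (∀ s ∈ Set.Icc (0 : ℝ) 1, f' s ≤ 0) → ∀ s ∈ Set.Icc (0 : ℝ) 1, f s ≤ f 0 := by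
    intro f f' hf hf' s hs
    have : AntitoneOn f (Set.Icc 0 1) := by
      apply antitoneOn_of_deriv_nonpos (convex_Icc 0 1)
      · exact fun x hx => (hf x hx).continuousAt.continuousWithinAt
      · exact fun x hx => (hf x (interior_subset hx)).differentiableAt.differentiableWithinAt
      · intro x hx
        rw [(hf x (interior_subset hx)).deriv]
        exact hf' x (interior_subset hx)
    exact this (by simp) hs hs.1
  have h3 : ∀ s ∈ Set.Icc (0 : ℝ) 1, φ₁ s - B * s ≤ φ₁ 0 - B * 0 :=
    anti (f' := fun s => φ₂ s - B * 1)
      (fun s hs => (h2 s hs).sub ((hasDerivAt_id s).const_mul B))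
      (fun s hs => by linarith [hB s hs])
  have h4 := anti (f := fun s => φ s - (φ₁ 0 * s + B / 2 * s ^ 2))
    (f' := fun s => φ₁ s - (φ₁ 0 * 1 + B / 2 * ((2 : ℕ) * s ^ (2 - 1))))
    (fun s hs => (h1 s hs).sub
      (((hasDerivAt_id s).const_mul (φ₁ 0)).add ((hasDerivAt_pow 2 s).const_mul (B / 2))))
    (fun s hs => by
      have := h3 s hs
      simp only [Nat.add_one_sub_one, pow_one]
      push_cast
      linarith) 1 (by simp)
  simp only [mul_zero, ne_eq, OfNat.ofNat_ne_zero, not_false_eq_true, zero_pow] at h4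
  linarith

theorem potential_add_le {z h : ℂ} {γ B : ℝ}
    (hψ : ∀ θ, |θ| < γ → HasDerivAt ψ (ψ₁ θ) θ) (hψ₁ : ∀ θ, |θ| < γ → HasDerivAt ψ₁ (ψ₂ θ) θ)
    (hs : ∀ s ∈ Set.Icc (0 : ℝ) 1, z + s * h ∈ Complex.slitPlane ∧ |(z + s * h).arg| < γ)
    (hB : ∀ s ∈ Set.Icc (0 : ℝ) 1, hess ψ ψ₁ ψ₂ (z + s * h).arg h ≤ B) :
    potential ψ (z + h) ≤ potential ψ z + (h * conj (potentialGrad ψ ψ₁ z)).re + B / 2 := by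
  have hc : ∀ s : ℝ, HasDerivAt (fun t : ℝ => z + t * h) h s := fun s => by
    simpa using ((hasDerivAt_id s).ofReal_comp.mul_const h).const_add z
  have := image_one_le_of_second_deriv_le
    (φ := fun s : ℝ => potential ψ (z + s * h))
    (φ₁ := fun s : ℝ => (h * conj (potentialGrad ψ ψ₁ (z + s * h))).re)
    (φ₂ := fun s : ℝ => hess ψ ψ₁ ψ₂ (z + s * h).arg h)
    (fun s h => hasDerivAt_potential_curve (hc s) (hs s h).1 (hψ _ (hs s h).2))
    (fun s h => hasDerivAt_re_mul_conj_potentialGrad (hc s) (hs s h).1 (hψ _ (hs s h).2)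
      (hψ₁ _ (hs s h).2)) hB
  simpa using this

/-- The mean value inequality for `Complex.log`: its derivative is at most `l⁻¹` in norm on the
convex half-plane. -/
theorem abs_arg_sub_arg_le {l : ℝ} (hl : 0 < l) {z w : ℂ} (hz : l ≤ z.re) (hw : l ≤ w.re) :
    |w.arg - z.arg| ≤ l⁻¹ * ‖w - z‖ := by
  have hconv : Convex ℝ {z : ℂ | l ≤ z.re} := convex_halfSpace_re_ge l
  have h := hconv.norm_image_sub_le_of_norm_hasDerivWithin_le (f := Complex.log)
    (f' := fun z => z⁻¹) (C := l⁻¹)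
    (fun x hx => (Complex.hasDerivAt_log (Or.inl (hl.trans_le hx))).hasDerivWithinAt)
    (fun x hx => by
      rw [norm_inv]
      exact inv_anti₀ hl (le_trans hx (Complex.re_le_norm x))) hz hw
  refine le_trans ?_ h
  rw [← Complex.log_im, ← Complex.log_im, ← Complex.sub_im]
  exact Complex.abs_im_le_norm _

theorem continuousOn_hess {s : Set ℝ} (h0 : ContinuousOn ψ s) (h1 : ContinuousOn ψ₁ s)
    (h2 : ContinuousOn ψ₂ s) :
    ContinuousOn (fun x : ℝ × ℂ => hess ψ ψ₁ ψ₂ x.1 x.2) (s ×ˢ Set.univ) := by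
  have hf : Set.MapsTo (Prod.fst : ℝ × ℂ → ℝ) (s ×ˢ Set.univ) s := fun x hx => hx.1
  have h0' := h0.comp continuousOn_fst hf
  have h1' := h1.comp continuousOn_fst hf
  have h2' := h2.comp continuousOn_fst hf
  have e : ∀ x : ℝ × ℂ, hess ψ ψ₁ ψ₂ x.1 x.2 =
      ((4 * ψ x.1 + ψ₂ x.1) * Complex.normSq x.2 -
        (((ψ₂ x.1 : ℂ) + (2 * ψ₁ x.1 : ℝ) * Complex.I) *
          Complex.exp (-(2 * x.1 * Complex.I)) * x.2 ^ 2).re) / 2 := fun x => by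
    rw [hess, Complex.mk_eq_add_mul_I]
  simp only [e]
  simp only [Function.comp_def] at h0' h1' h2'
  have hn : Continuous fun x : ℝ × ℂ => Complex.normSq x.2 :=
    Complex.continuous_normSq.comp continuous_snd
  have he : Continuous fun x : ℝ × ℂ => Complex.exp (-(2 * x.1 * Complex.I)) * x.2 ^ 2 := by
    fun_prop
  refine ContinuousOn.div_const (ContinuousOn.sub (((h0'.const_mul 4).add h2').mul hn.continuousOn)
    (Complex.continuous_re.comp_continuousOn ?_)) 2
  simp only [mul_assoc (_ + _ : ℂ)]
  refine ContinuousOn.mul (ContinuousOn.add ?_ (ContinuousOn.mul ?_ continuousOn_const))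
    he.continuousOn
  · exact Complex.continuous_ofReal.comp_continuousOn h2'
  · exact Complex.continuous_ofReal.comp_continuousOn (h1'.const_mul 2)

/-- Far from the apex of a wedge, `r ^ 2 * ψ θ` differs little from its second-order Taylor
polynomial. -/
theorem exists_potential_add_le {γ η R ω : ℝ} (h0 : 0 < η) (hπ : η < Real.pi) (hηγ : η / 2 < γ)
    (hψ : ∀ θ, |θ| < γ → HasDerivAt ψ (ψ₁ θ) θ) (hψ₁ : ∀ θ, |θ| < γ → HasDerivAt ψ₁ (ψ₂ θ) θ)
    (hψ₂ : ∀ θ, |θ| < γ → ContinuousAt ψ₂ θ) (hR : 0 ≤ R) (hω : 0 < ω) :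
    ∃ L₀ : ℝ, ∀ z h : ℂ, L₀ ≤ z.re → ‖h‖ ≤ R →
      (∀ s ∈ Set.Icc (0 : ℝ) 1, z + s * h ∈ wedge η) →
      potential ψ (z + h) ≤ potential ψ z + (h * conj (potentialGrad ψ ψ₁ z)).re +
        (hess ψ ψ₁ ψ₂ z.arg h + ω) / 2 := by
  set I := Set.Icc (-(η / 2)) (η / 2)
  have hI : ∀ θ ∈ I, |θ| < γ := fun θ hθ => (abs_le.2 hθ).trans_lt hηγ
  have hcont := continuousOn_hess (s := I) (fun θ hθ => (hψ θ (hI θ hθ)).continuousAt.continuousWithinAt)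
    (fun θ hθ => (hψ₁ θ (hI θ hθ)).continuousAt.continuousWithinAt)
    (fun θ hθ => (hψ₂ θ (hI θ hθ)).continuousWithinAt)
  have hK : IsCompact (I ×ˢ Metric.closedBall (0 : ℂ) R) :=
    isCompact_Icc.prod (isCompact_closedBall 0 R)
  have huc := hK.uniformContinuousOn_of_continuous
    (hcont.mono (Set.prod_mono_right (Set.subset_univ _)))
  obtain ⟨δ, hδ, hδ'⟩ := Metric.uniformContinuousOn_iff.1 huc ω hω
  -- Along the segment the real part stays above `l = R/δ + 1`, so the angle moves by at most `R/l <
  -- δ`, the modulus of continuity of the Hessian.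
  refine ⟨R + (R / δ + 1), fun z h hz hh hseg => ?_⟩
  set l := R / δ + 1
  have hl : 0 < l := by positivity
  have hmem : ∀ s ∈ Set.Icc (0 : ℝ) 1, (z + s * h).arg ∈ I := fun s hs =>
    ⟨(hseg s hs).2.1.le, (hseg s hs).2.2.le⟩
  have hz0 : z ∈ wedge η := by simpa using hseg 0 (by simp)
  refine potential_add_le hψ hψ₁ (fun s hs => ⟨Or.inl (re_pos_of_mem_wedge h0 hπ (hseg s hs)),
    hI _ (hmem s hs)⟩) fun s hs => ?_
  have hsh : ‖(s : ℂ) * h‖ ≤ R := by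
    rw [norm_mul, Complex.norm_real, Real.norm_of_nonneg hs.1]
    calc s * ‖h‖ ≤ 1 * R := mul_le_mul hs.2 hh (norm_nonneg _) zero_le_one
      _ = R := one_mul R
  have hre : l ≤ (z + s * h).re := by
    have := (abs_le.1 ((Complex.abs_re_le_norm (s * h)).trans hsh)).1
    rw [Complex.add_re]
    linarith
  have harg := abs_arg_sub_arg_le hl (z := z) (w := z + s * h) (by linarith) hre
  have hdist : dist ((z + s * h).arg, h) (z.arg, h) < δ := by
    rw [Prod.dist_eq, dist_self, max_eq_left dist_nonneg, Real.dist_eq]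
    refine harg.trans_lt ?_
    rw [add_sub_cancel_left, inv_mul_lt_iff₀ hl]
    refine hsh.trans_lt ?_
    rw [add_mul, div_mul_cancel₀ _ hδ.ne']
    linarith
  have hhR : h ∈ Metric.closedBall (0 : ℂ) R := by simpa using hh
  have hzI : z.arg ∈ I := ⟨hz0.2.1.le, hz0.2.2.le⟩
  have := hδ' _ ⟨hmem s hs, hhR⟩ (z.arg, h) ⟨hzI, hhR⟩ hdist
  rw [Real.dist_eq] at this
  linarith [(abs_lt.1 this).2]

end

/-! ### Moments of the noise -/

section
variable {μ : Measure ℂ}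

/-- The infimum need not be attained, as the balls are open; countably many radii decreasing to it
give the non-strict bound. -/
theorem ae_norm_le_reach [IsProbabilityMeasure μ] (hμ : IsNoiseMeasure μ) :
    ∀ᵐ z ∂μ, 1 + ‖z‖ ≤ reach μ := by
  set S := {R : ℝ | μ (Metric.ball 0 R) = 1}
  have hne : S.Nonempty := by
    obtain ⟨K, hK, hK0⟩ := hμ.compactSupport
    obtain ⟨R, hR⟩ := hK.isBounded.subset_ball (0 : ℂ)
    refine ⟨R, ?_⟩
    rw [Set.mem_ofPred_eq, ← prob_compl_eq_zero_iff Metric.isOpen_ball.measurableSet]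
    exact measure_mono_null (Set.compl_subset_compl.2 hR) hK0
  have hn : ∀ n : ℕ, ∀ᵐ z ∂μ, ‖z‖ < sInf S + 1 / ((n : ℝ) + 1) := by
    intro n
    obtain ⟨R, hR, hR'⟩ := exists_lt_of_csInf_lt hne
      (show sInf S < sInf S + 1 / ((n : ℝ) + 1) by
        have : 0 < 1 / ((n : ℝ) + 1) := by positivity
        linarith)
    have hae : ∀ᵐ z ∂μ, z ∈ Metric.ball (0 : ℂ) R :=
      (mem_ae_iff_prob_eq_one₀ Metric.isOpen_ball.nullMeasurableSet).2 hR
    filter_upwards [hae] with z hz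
    exact (mem_ball_zero_iff.1 hz).trans hR'
  filter_upwards [ae_all_iff.2 hn] with z hz
  rw [reach]
  have := le_of_forall_pos_lt_add (a := ‖z‖) (b := sInf S) fun δ hδ => by
    obtain ⟨n, hn⟩ := exists_nat_one_div_lt hδ
    linarith [hz n]
  linarith

/-- A ball of negative radius is empty, so it cannot have mass one. -/
theorem one_le_reach (μ : Measure ℂ) : 1 ≤ reach μ := by
  have : 0 ≤ sInf {R : ℝ | μ (Metric.ball 0 R) = 1} := by
    apply Real.sInf_nonneg
    intro R hR
    by_contra! h
    rw [Set.mem_ofPred_eq, Metric.ball_eq_empty.2 h.le, measure_empty] at hR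
    exact zero_ne_one hR
  rw [reach]
  linarith

theorem integrable_of_continuous [IsProbabilityMeasure μ] (hμ : IsNoiseMeasure μ) {E : Type*}
    [NormedAddCommGroup E] {f : ℂ → E} (hf : Continuous f) : Integrable f μ := by
  obtain ⟨K, hK, hK0⟩ := hμ.compactSupport
  have hr : μ.restrict K = μ := Measure.restrict_eq_self_of_ae_mem (by
    rw [ae_iff]
    exact hK0)
  rw [← hr]
  exact hf.continuousOn.integrableOn_compact hK

/-- Complex conjugation fixes `1`, so it preserves `μ`, and it reverses the sign of the integrand.
-/
theorem integral_re_mul_im [IsProbabilityMeasure μ] (hμ : IsNoiseMeasure μ) :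
    ∫ z, z.re * z.im ∂μ = 0 := by
  have h := hμ.map_eq Complex.conjLIE (by simp)
  have h1 : ∫ z, z.re * z.im ∂μ = ∫ z, z.re * z.im ∂(μ.map Complex.conjLIE) := by rw [h]
  have h2 : Continuous fun z : ℂ => z.re * z.im := by fun_prop
  rw [integral_map Complex.conjLIE.continuous.measurable.aemeasurable h2.aestronglyMeasurable] at h1
  simp only [Complex.conjLIE_apply, Complex.conj_re, Complex.conj_im, mul_neg,
    integral_neg] at h1
  linarith

theorem integral_re_eq_zero [IsProbabilityMeasure μ] (hμ : IsNoiseMeasure μ) :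
    ∫ z, z.re ∂μ = 0 := by
  have := integral_re (𝕜 := ℂ) (integrable_of_continuous hμ continuous_id)
  simp only [id, hμ.mean_zero] at this
  simpa using this

theorem integral_im_eq_zero [IsProbabilityMeasure μ] (hμ : IsNoiseMeasure μ) :
    ∫ z, z.im ∂μ = 0 := by
  have := integral_im (𝕜 := ℂ) (integrable_of_continuous hμ continuous_id)
  simp only [id, hμ.mean_zero] at this
  simpa using this

/-- If the variance vanished, division by zero would make the exponent `0`. -/
theorem integral_im_sq_pos {p : ℝ} (hp : 1 < p) (hpμ : exponent μ = p) :
    0 < ∫ z, z.im ^ 2 ∂μ := by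
  refine lt_of_le_of_ne (integral_nonneg fun z => sq_nonneg _) fun h => ?_
  rw [exponent, ← h, div_zero] at hpμ
  linarith

/-- The mean of a quadratic polynomial of the displacement `1 + ζ` of a unit move. -/
theorem integral_quadratic [IsProbabilityMeasure μ] (hμ : IsNoiseMeasure μ) {p : ℝ} (hp : 1 < p)
    (hpμ : exponent μ = p) (a t : ℝ) (b s : ℂ) :
    ∫ ζ, (a + (b * (1 + ζ)).re + (t * Complex.normSq (1 + ζ) - (s * (1 + ζ) ^ 2).re)) ∂μ =
      a + b.re + (∫ z, z.im ^ 2 ∂μ) * (p * t - (p - 2) * s.re) := by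
  have hc := integral_im_sq_pos hp hpμ
  -- The definition of the exponent, solved as `1 + C₁₁ = (p-1) C₂₂`.
  have hA : ∫ z, z.re ^ 2 ∂μ = (p - 1) * (∫ z, z.im ^ 2 ∂μ) - 1 := by
    have := (div_eq_iff hc.ne').1 hpμ
    linarith
  have e : ∀ ζ : ℂ, a + (b * (1 + ζ)).re +
      (t * Complex.normSq (1 + ζ) - (s * (1 + ζ) ^ 2).re) =
      (a + b.re + t - s.re) + (b.re + 2 * t - 2 * s.re) * ζ.re + (2 * s.im - b.im) * ζ.im +
        (t - s.re) * ζ.re ^ 2 + (t + s.re) * ζ.im ^ 2 + 2 * s.im * (ζ.re * ζ.im) := fun ζ => by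
    simp only [Complex.mul_re, Complex.normSq_apply, sq, Complex.add_re, Complex.add_im,
      Complex.one_re, Complex.one_im, Complex.mul_im]
    ring
  simp only [e]
  rw [integral_add, integral_add, integral_add, integral_add, integral_add]
  rotate_left
  iterate 10 exact integrable_of_continuous hμ (by fun_prop)
  simp only [integral_const_mul, integral_re_mul_im hμ, integral_re_eq_zero hμ,
    integral_im_eq_zero hμ, hA, integral_const, probReal_univ, one_smul]
  ring

/-- The mean of the Hessian of `r ^ 2 * ψ θ` at `θ` in the direction of the noisy move `v`. -/
noncomputable def meanHess (μ : Measure ℂ) (p : ℝ) (ψ ψ₁ ψ₂ : ℝ → ℝ) (θ : ℝ) (v : ℂ) : ℝ :=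
  (∫ z, z.im ^ 2 ∂μ) * (p * ((4 * ψ θ + ψ₂ θ) * Complex.normSq v) -
    (p - 2) * ((⟨ψ₂ θ, 2 * ψ₁ θ⟩ : ℂ) * Complex.exp (-(2 * θ * Complex.I)) * v ^ 2).re) / 2

theorem integral_taylor [IsProbabilityMeasure μ] (hμ : IsNoiseMeasure μ) {p : ℝ} (hp : 1 < p)
    (hpμ : exponent μ = p) (ψ ψ₁ ψ₂ : ℝ → ℝ) (θ a ω : ℝ) (g v : ℂ) :
    ∫ ζ, (a + ((v + v * ζ) * conj g).re + (hess ψ ψ₁ ψ₂ θ (v + v * ζ) + ω) / 2) ∂μ =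
      a + (v * conj g).re + (meanHess μ p ψ ψ₁ ψ₂ θ v + ω) / 2 := by
  set s := (⟨ψ₂ θ, 2 * ψ₁ θ⟩ : ℂ) * Complex.exp (-(2 * θ * Complex.I)) * v ^ 2 with hs
  set t := (4 * ψ θ + ψ₂ θ) * Complex.normSq v with ht
  have e : ∀ ζ : ℂ, a + ((v + v * ζ) * conj g).re + (hess ψ ψ₁ ψ₂ θ (v + v * ζ) + ω) / 2 =
      (a + ω / 2) + (v * conj g * (1 + ζ)).re +
        (t / 4 * Complex.normSq (1 + ζ) - (((1 / 4 : ℝ) : ℂ) * s * (1 + ζ) ^ 2).re) := fun ζ => by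
    have h1 : v + v * ζ = v * (1 + ζ) := by ring
    have h2 : v * (1 + ζ) * conj g = v * conj g * (1 + ζ) := by ring
    have h3 : (⟨ψ₂ θ, 2 * ψ₁ θ⟩ : ℂ) * Complex.exp (-(2 * θ * Complex.I)) * (v * (1 + ζ)) ^ 2 =
      s * (1 + ζ) ^ 2 := by rw [hs]; ring
    rw [hess, h1, h2, h3, Complex.normSq_mul, mul_assoc (((1 / 4 : ℝ) : ℂ)), Complex.re_ofReal_mul, ht]
    ring
  simp only [e]
  rw [integral_quadratic hμ hp hpμ, Complex.re_ofReal_mul, meanHess, ← hs, ← ht]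
  ring

end

/-! ### The mean change of the potential in one turn -/

section
variable {μ : Measure ℂ} {ψ ψ₁ ψ₂ : ℝ → ℝ} {p : ℝ}

theorem normSq_potentialGrad (z : ℂ) :
    Complex.normSq (potentialGrad ψ ψ₁ z) =
      Complex.normSq z * (4 * ψ z.arg ^ 2 + ψ₁ z.arg ^ 2) := by
  rw [potentialGrad, Complex.normSq_mul, Complex.normSq_mk (2 * ψ z.arg)]
  ring

/-- Since `exp(-2iθ) z² = |z|²`, the rotation in the Hessian cancels against the gradient, leaving
the expression whose sign `exists_profile` controls. -/
theorem meanHess_grad (z : ℂ) (c : ℝ) :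
    meanHess μ p ψ ψ₁ ψ₂ z.arg (c * potentialGrad ψ ψ₁ z) =
      (∫ z, z.im ^ 2 ∂μ) * (c ^ 2 * Complex.normSq z) *
        (p * (4 * ψ z.arg ^ 2 + ψ₁ z.arg ^ 2) * (4 * ψ z.arg + ψ₂ z.arg) -
        (p - 2) * (ψ₂ z.arg * (4 * ψ z.arg ^ 2 - ψ₁ z.arg ^ 2) - 8 * ψ z.arg * ψ₁ z.arg ^ 2)) / 2 := by
  have h1 : Complex.exp (-(2 * z.arg * Complex.I)) * z ^ 2 = (Complex.normSq z : ℂ) := by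
    have h2 : Complex.exp (-(2 * z.arg * Complex.I)) * Complex.exp (z.arg * Complex.I) ^ 2 = 1 := by
      rw [← Complex.exp_nat_mul, ← Complex.exp_add]
      convert Complex.exp_zero using 2
      push_cast
      ring
    have h3 := Complex.norm_mul_exp_arg_mul_I z
    rw [Complex.normSq_eq_norm_sq]
    push_cast
    calc _ = Complex.exp (-(2 * z.arg * Complex.I)) *
          (‖z‖ * Complex.exp (z.arg * Complex.I)) ^ 2 := by rw [h3]
      _ = _ := by linear_combination (‖z‖ : ℂ) ^ 2 * h2
  have h4 : (⟨ψ₂ z.arg, 2 * ψ₁ z.arg⟩ : ℂ) * Complex.exp (-(2 * z.arg * Complex.I)) *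
      (c * potentialGrad ψ ψ₁ z) ^ 2 = ((c ^ 2 * Complex.normSq z : ℝ) : ℂ) *
      ((⟨ψ₂ z.arg, 2 * ψ₁ z.arg⟩ : ℂ) * (⟨2 * ψ z.arg, ψ₁ z.arg⟩ : ℂ) ^ 2) := by
    rw [potentialGrad]
    push_cast
    rw [← h1]
    ring
  rw [meanHess, h4, Complex.re_ofReal_mul, Complex.normSq_mul, normSq_potentialGrad,
    Complex.normSq_ofReal]
  simp only [sq, Complex.mul_re, Complex.mul_im]
  ring

/-- A quadratic form is Lipschitz on a ball: factor `v² - y² = (v + y)(v - y)`, and likewise for the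
squared norms. This bounds what player I gains by deviating from `y`. -/
theorem meanHess_sub_le (hp : 0 ≤ p) {θ K : ℝ}
    (hK : p * |4 * ψ θ + ψ₂ θ| + |p - 2| * (|ψ₂ θ| + |2 * ψ₁ θ|) ≤ K) {ε : ℝ} {v y : ℂ}
    (hv : ‖v‖ ≤ ε) (hy : ‖y‖ ≤ ε) :
    meanHess μ p ψ ψ₁ ψ₂ θ v - meanHess μ p ψ ψ₁ ψ₂ θ y ≤
      (∫ z, z.im ^ 2 ∂μ) * (K * ε * ‖v - y‖) := by
  have hC : 0 ≤ ∫ z, z.im ^ 2 ∂μ := integral_nonneg fun z => sq_nonneg _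
  set S := (⟨ψ₂ θ, 2 * ψ₁ θ⟩ : ℂ) * Complex.exp (-(2 * θ * Complex.I)) with hS
  set T := 4 * ψ θ + ψ₂ θ
  set d := ‖v - y‖ with hd
  have hε : 0 ≤ ε := (norm_nonneg v).trans hv
  have hSn : ‖S‖ ≤ |ψ₂ θ| + |2 * ψ₁ θ| := by
    rw [hS, norm_mul, Complex.norm_exp]
    have : (-(2 * (θ : ℂ) * Complex.I)).re = 0 := by simp
    rw [this, Real.exp_zero, mul_one]
    exact Complex.norm_le_abs_re_add_abs_im _
  have h1 : |Complex.normSq v - Complex.normSq y| ≤ 2 * ε * d := by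
    rw [Complex.normSq_eq_norm_sq, Complex.normSq_eq_norm_sq, sq_sub_sq, abs_mul,
      abs_of_nonneg (by positivity)]
    exact mul_le_mul (by linarith) (abs_norm_sub_norm_le v y) (abs_nonneg _) (by positivity)
  have h2 : |(S * v ^ 2).re - (S * y ^ 2).re| ≤ (|ψ₂ θ| + |2 * ψ₁ θ|) * (2 * ε * d) := by
    rw [← Complex.sub_re]
    refine (Complex.abs_re_le_norm _).trans ?_
    rw [← mul_sub, sq_sub_sq, norm_mul S, norm_mul (v + y)]
    exact mul_le_mul hSn (mul_le_mul ((norm_add_le _ _).trans (by linarith)) le_rfl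
      (norm_nonneg _) (by positivity)) (by positivity) (by positivity)
  have h3 : p * (T * (Complex.normSq v - Complex.normSq y)) ≤ p * (|T| * (2 * ε * d)) := by
    refine mul_le_mul_of_nonneg_left ((le_abs_self _).trans ?_) hp
    rw [abs_mul]
    exact mul_le_mul_of_nonneg_left h1 (abs_nonneg _)
  have h4 : -((p - 2) * ((S * v ^ 2).re - (S * y ^ 2).re)) ≤
      |p - 2| * ((|ψ₂ θ| + |2 * ψ₁ θ|) * (2 * ε * d)) := by
    refine (neg_le_abs _).trans ?_
    rw [abs_mul]
    exact mul_le_mul_of_nonneg_left h2 (abs_nonneg _)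
  have h5 : 0 ≤ 2 * ε * d := by positivity
  have h6 := mul_le_mul_of_nonneg_right hK h5
  rw [meanHess, meanHess, ← hS, ← sub_div, ← mul_sub]
  rw [div_le_iff₀ two_pos, mul_assoc (∫ z, z.im ^ 2 ∂μ)]
  refine mul_le_mul_of_nonneg_left ?_ hC
  linarith

/-- If player II pulls against the gradient, then the potential decreases on average, whatever
player I does. -/
theorem mean_change_le (hp : 0 ≤ p) {z : ℂ} {K κ ω ε : ℝ} (hz : z ≠ 0) (hψ : 0 < ψ z.arg)
    (hε : 0 < ε)
    (hK : p * |4 * ψ z.arg + ψ₂ z.arg| + |p - 2| * (|ψ₂ z.arg| + |2 * ψ₁ z.arg|) ≤ K)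
    (hκ : p * (4 * ψ z.arg ^ 2 + ψ₁ z.arg ^ 2) * (4 * ψ z.arg + ψ₂ z.arg) -
        (p - 2) * (ψ₂ z.arg * (4 * ψ z.arg ^ 2 - ψ₁ z.arg ^ 2) - 8 * ψ z.arg * ψ₁ z.arg ^ 2) ≤
        -κ * (4 * ψ z.arg ^ 2 + ψ₁ z.arg ^ 2))
    (hωκ : 8 * ω ≤ (∫ z, z.im ^ 2 ∂μ) * ε ^ 2 * κ)
    (hg : ((∫ z, z.im ^ 2 ∂μ) * K) ^ 2 * ε ^ 3 ≤ 8 * ω * ‖potentialGrad ψ ψ₁ z‖) {v : ℂ}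
    (hv : ‖v‖ ≤ ε) :
    ((v * conj (potentialGrad ψ ψ₁ z)).re + (meanHess μ p ψ ψ₁ ψ₂ z.arg v + ω) / 2) +
      ((((-(ε / ‖potentialGrad ψ ψ₁ z‖) : ℝ) * potentialGrad ψ ψ₁ z) *
        conj (potentialGrad ψ ψ₁ z)).re +
      (meanHess μ p ψ ψ₁ ψ₂ z.arg
        ((-(ε / ‖potentialGrad ψ ψ₁ z‖) : ℝ) * potentialGrad ψ ψ₁ z) + ω) / 2) ≤ -(2 * ω) := by
  have hC : 0 ≤ ∫ z, z.im ^ 2 ∂μ := integral_nonneg fun z => sq_nonneg _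
  have hsq := normSq_potentialGrad (ψ := ψ) (ψ₁ := ψ₁) z
  have hN : 0 < 4 * ψ z.arg ^ 2 + ψ₁ z.arg ^ 2 := by positivity
  have hzz : 0 < Complex.normSq z := Complex.normSq_pos.2 hz
  have hJ := meanHess_grad (μ := μ) (p := p) (ψ := ψ) (ψ₁ := ψ₁) (ψ₂ := ψ₂) z
  set g := potentialGrad ψ ψ₁ z with hgdef
  have hg0 : 0 < ‖g‖ := by
    rw [norm_pos_iff, ← Complex.normSq_pos, hsq]
    positivity
  rw [Complex.normSq_eq_norm_sq] at hsq
  set c := ε / ‖g‖ with hc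
  have hcg : c * ‖g‖ = ε := div_mul_cancel₀ _ hg0.ne'
  set y : ℂ := (c : ℂ) * g with hy
  have hc0 : 0 < c := by positivity
  have hyn : ‖y‖ = ε := by
    rw [hy, norm_mul, Complex.norm_real, Real.norm_of_nonneg hc0.le, hcg]
  -- Stated for both signs of the multiplier: the second-order mean is even, so it is equally
  -- negative for II's move and for the opposite move `y`.
  have hJle : ∀ c' : ℝ, c' ^ 2 = c ^ 2 →
      meanHess μ p ψ ψ₁ ψ₂ z.arg (c' * g) ≤ -(4 * ω) := by
    intro c' hc'
    rw [hJ c', hc']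
    have h1 : c ^ 2 * Complex.normSq z * (4 * ψ z.arg ^ 2 + ψ₁ z.arg ^ 2) = ε ^ 2 := by
      rw [mul_assoc, ← hsq, ← hcg]
      ring
    have h2 := mul_le_mul_of_nonneg_left hκ (mul_nonneg hC (by positivity : 0 ≤ c ^ 2 * Complex.normSq z))
    have h3 : (∫ z, z.im ^ 2 ∂μ) * (c ^ 2 * Complex.normSq z) *
        (-κ * (4 * ψ z.arg ^ 2 + ψ₁ z.arg ^ 2)) = -((∫ z, z.im ^ 2 ∂μ) * ε ^ 2 * κ) := by
      rw [← h1]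
      ring
    linarith
  have hJy := hJle c rfl
  have hJy' := hJle (-c) (by ring)
  have hsub := meanHess_sub_le (μ := μ) hp hK hv hyn.le
  have hII : (((-c : ℝ) * g) * conj g).re = -(ε * ‖g‖) := by
    rw [mul_assoc, Complex.mul_conj, Complex.re_ofReal_mul, Complex.ofReal_re,
      Complex.normSq_eq_norm_sq, ← hcg]
    ring
  -- The law of cosines: `y` maximizes the first-order term over the ball, with a quadratic loss
  -- away from it.
  have hI : (v * conj g).re * (2 * ε) ≤ (2 * ε ^ 2 - ‖v - y‖ ^ 2) * ‖g‖ := by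
    have h1 : ‖v - y‖ ^ 2 = ‖v‖ ^ 2 + ε ^ 2 - 2 * (c * (v * conj g).re) := by
      rw [← hyn, ← Complex.normSq_eq_norm_sq, ← Complex.normSq_eq_norm_sq, ← Complex.normSq_eq_norm_sq,
        Complex.normSq_sub, hy, map_mul (starRingEnd ℂ), Complex.conj_ofReal, mul_left_comm, Complex.re_ofReal_mul]
    have h2 : ‖v‖ ^ 2 ≤ ε ^ 2 := by gcongr
    have h3 : 2 * (c * (v * conj g).re) ≤ 2 * ε ^ 2 - ‖v - y‖ ^ 2 := by linarith
    calc (v * conj g).re * (2 * ε) = 2 * (c * (v * conj g).re) * ‖g‖ := by rw [← hcg]; ring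
      _ ≤ _ := by gcongr
  set d := ‖v - y‖
  set A := ∫ z, z.im ^ 2 ∂μ
  set X := (v * conj g).re
  -- Completing the square in `d`: the linear gain minus the quadratic loss is at most `(AK)² ε³ /
  -- (8‖g‖)`, which `hg` bounds by `ω`.
  have hfin : X - ε * ‖g‖ + A * (K * ε * d) / 2 ≤ ω := by
    have h1 : (X - ε * ‖g‖ + A * (K * ε * d) / 2 - ω) * (8 * ‖g‖ * ε) ≤ 0 := by
      have h2 := mul_le_mul_of_nonneg_left hI (show 0 ≤ 4 * ‖g‖ by positivity)
      have h3 := mul_le_mul_of_nonneg_left hg hε.le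
      nlinarith [sq_nonneg (2 * ‖g‖ * d - A * K * ε ^ 2)]
    by_contra! hcon
    have := mul_pos (sub_pos.2 hcon) (by positivity : 0 < 8 * ‖g‖ * ε)
    linarith
  rw [hII]
  linarith

end

/-! ### Player II's strategy and the Lyapunov function -/

theorem lintegral_transition {μ : Measure ℂ} {D : Set ℂ} {ε : ℝ} [IsProbabilityMeasure μ]
    (SI SII : Strategy μ D ε) (n : ℕ) (h : History n) {f : ℂ × ℂ → ℝ≥0∞} (hf : Measurable f) :
    ∫⁻ y, f y ∂transition SI SII n h =
      ((∫⁻ ζ, f (step SI SII n (h, (true, ζ))) ∂μ) +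
        ∫⁻ ζ, f (step SI SII n (h, (false, ζ))) ∂μ) / 2 := by
  have hm : Measurable fun x => f (step SI SII n x) := hf.comp (measurable_step SI SII n)
  have hm' : Measurable fun y : Bool × ℂ => f (step SI SII n (h, y)) :=
    hm.comp measurable_prodMk_left
  rw [transition, Kernel.map_apply _ (measurable_step SI SII n),
    lintegral_map hf (measurable_step SI SII n), Kernel.lintegral_id_prod hm,
    Kernel.const_apply, lintegral_prod _ hm'.aemeasurable, lintegral_fintype, Fintype.sum_bool]
  simp only [PMF.toMeasure_apply_singleton _ _ (MeasurableSet.singleton _),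
    PMF.uniformOfFintype_apply, Fintype.card_bool, Nat.cast_ofNat]
  rw [← add_mul, ENNReal.div_eq_inv_mul, mul_comm]

theorem measurable_ite_const_of_continuousOn {α β : Type*} [TopologicalSpace α] [MeasurableSpace α]
    [BorelSpace α] [TopologicalSpace β] [MeasurableSpace β] [BorelSpace β] {s : Set α}
    [DecidablePred (· ∈ s)] {f : α → β} (hs : MeasurableSet s) (hf : ContinuousOn f s) (c : β) :
    Measurable fun x => if x ∈ s then f x else c :=
  hf.measurable_piecewise continuousOn_const hs

/-- Bounds for the angular part of a `p`-superharmonic function, uniform on a smaller wedge. -/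
theorem exists_uniform_bounds {ψ ψ₁ ψ₂ : ℝ → ℝ} {p β : ℝ} (hβ : 0 ≤ β)
    (h0 : ContinuousOn ψ (Set.Icc (-β) β)) (h1 : ContinuousOn ψ₁ (Set.Icc (-β) β))
    (h2 : ContinuousOn ψ₂ (Set.Icc (-β) β)) (hpos : ∀ θ ∈ Set.Icc (-β) β, 0 < ψ θ)
    (hneg : ∀ θ ∈ Set.Icc (-β) β, p * (4 * ψ θ ^ 2 + ψ₁ θ ^ 2) * (4 * ψ θ + ψ₂ θ) -
        (p - 2) * (ψ₂ θ * (4 * ψ θ ^ 2 - ψ₁ θ ^ 2) - 8 * ψ θ * ψ₁ θ ^ 2) < 0) :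
    ∃ m κ K : ℝ, 0 < m ∧ 0 < κ ∧ ∀ θ ∈ Set.Icc (-β) β, m ≤ ψ θ ∧
      p * |4 * ψ θ + ψ₂ θ| + |p - 2| * (|ψ₂ θ| + |2 * ψ₁ θ|) ≤ K ∧
      p * (4 * ψ θ ^ 2 + ψ₁ θ ^ 2) * (4 * ψ θ + ψ₂ θ) -
        (p - 2) * (ψ₂ θ * (4 * ψ θ ^ 2 - ψ₁ θ ^ 2) - 8 * ψ θ * ψ₁ θ ^ 2) ≤
        -κ * (4 * ψ θ ^ 2 + ψ₁ θ ^ 2) := by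
  have hne : (Set.Icc (-β) β).Nonempty := ⟨0, by simpa using hβ⟩
  have hN : ∀ θ ∈ Set.Icc (-β) β, 0 < 4 * ψ θ ^ 2 + ψ₁ θ ^ 2 := fun θ hθ => by
    have := hpos θ hθ
    positivity
  obtain ⟨a, ha, ha'⟩ := isCompact_Icc.exists_isMinOn hne h0
  obtain ⟨b, hb, hb'⟩ := isCompact_Icc.exists_isMaxOn hne
    (f := fun θ => p * |4 * ψ θ + ψ₂ θ| + |p - 2| * (|ψ₂ θ| + |2 * ψ₁ θ|))
    (((((h0.const_mul 4).add h2).abs).const_mul p).add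
      ((h2.abs.add (h1.const_mul 2).abs).const_mul _))
  obtain ⟨c, hc, hc'⟩ := isCompact_Icc.exists_isMaxOn hne
    (f := fun θ => (p * (4 * ψ θ ^ 2 + ψ₁ θ ^ 2) * (4 * ψ θ + ψ₂ θ) -
        (p - 2) * (ψ₂ θ * (4 * ψ θ ^ 2 - ψ₁ θ ^ 2) - 8 * ψ θ * ψ₁ θ ^ 2)) /
        (4 * ψ θ ^ 2 + ψ₁ θ ^ 2))
    (ContinuousOn.div (by fun_prop) (by fun_prop) fun θ hθ => (hN θ hθ).ne')
  refine ⟨ψ a, _, _, hpos a ha, neg_pos.2 (div_neg_of_neg_of_pos (hneg c hc) (hN c hc)),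
    fun θ hθ => ⟨ha' hθ, hb' hθ, ?_⟩⟩
  rw [neg_neg, ← div_le_iff₀ (hN θ hθ)]
  exact hc' hθ

section
variable {μ : Measure ℂ} [IsProbabilityMeasure μ] {ψ ψ₁ ψ₂ : ℝ → ℝ} {p η γ : ℝ}

/-- The mean of the potential after a noisy move is bounded by its second-order expansion. -/
theorem lintegral_potential_le (hμ : IsNoiseMeasure μ) (hp : 1 < p) (hpμ : exponent μ = p)
    (hψ0 : ∀ θ, |θ| < γ → 0 < ψ θ) (hηγ : η / 2 < γ) {ω ε : ℝ} (hω : 0 < ω) {z v : ℂ}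
    (hv : ‖v‖ ≤ ε)
    (hmem : ∀ h : ℂ, ‖h‖ ≤ reach μ * ε → z + h ∈ wedge η)
    (htaylor : ∀ h : ℂ, ‖h‖ ≤ reach μ * ε → potential ψ (z + h) ≤ potential ψ z +
      (h * conj (potentialGrad ψ ψ₁ z)).re + (hess ψ ψ₁ ψ₂ z.arg h + ω) / 2) :
    0 ≤ potential ψ z + ω + (v * conj (potentialGrad ψ ψ₁ z)).re +
        (meanHess μ p ψ ψ₁ ψ₂ z.arg v + ω) / 2 ∧
    ∫⁻ ζ, ENNReal.ofReal (potential ψ (z + v + v * ζ) + ω) ∂μ ≤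
      ENNReal.ofReal (potential ψ z + ω + (v * conj (potentialGrad ψ ψ₁ z)).re +
        (meanHess μ p ψ ψ₁ ψ₂ z.arg v + ω) / 2) := by
  rw [← integral_taylor hμ hp hpμ]
  have hnorm : ∀ᵐ ζ ∂μ, ‖v + v * ζ‖ ≤ reach μ * ε := by
    filter_upwards [ae_norm_le_reach hμ] with ζ hζ
    calc ‖v + v * ζ‖ ≤ ‖v‖ + ‖v‖ * ‖ζ‖ := (norm_add_le _ _).trans_eq (by rw [norm_mul])
      _ = (1 + ‖ζ‖) * ‖v‖ := by ring
      _ ≤ reach μ * ε := mul_le_mul hζ hv (norm_nonneg _) (by linarith [one_le_reach μ])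
  have hle : ∀ᵐ ζ ∂μ, potential ψ (z + v + v * ζ) + ω ≤ potential ψ z + ω +
      ((v + v * ζ) * conj (potentialGrad ψ ψ₁ z)).re +
        (hess ψ ψ₁ ψ₂ z.arg (v + v * ζ) + ω) / 2 := by
    filter_upwards [hnorm] with ζ hζ
    have := htaylor _ hζ
    rw [add_assoc z]
    linarith
  have hpos : ∀ᵐ ζ ∂μ, 0 ≤ potential ψ (z + v + v * ζ) + ω := by
    filter_upwards [hnorm] with ζ hζ
    have hm := hmem _ hζ
    rw [← add_assoc] at hm
    have := hψ0 _ ((abs_lt.2 hm.2).trans hηγ)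
    have := mul_nonneg (Complex.normSq_nonneg (z + v + v * ζ)) this.le
    rw [potential]
    linarith
  have hcont : Continuous fun ζ : ℂ => potential ψ z + ω +
      ((v + v * ζ) * conj (potentialGrad ψ ψ₁ z)).re +
        (hess ψ ψ₁ ψ₂ z.arg (v + v * ζ) + ω) / 2 := by
    simp only [hess, Complex.normSq_apply]
    fun_prop
  have hpos' : 0 ≤ᵐ[μ] fun ζ : ℂ => potential ψ z + ω +
      ((v + v * ζ) * conj (potentialGrad ψ ψ₁ z)).re +
        (hess ψ ψ₁ ψ₂ z.arg (v + v * ζ) + ω) / 2 := by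
    filter_upwards [hle, hpos] with ζ h1 h2
    exact h2.trans h1
  refine ⟨integral_nonneg_of_ae hpos', ?_⟩
  rw [ofReal_integral_eq_lintegral_ofReal (integrable_of_continuous hμ hcont) hpos']
  exact lintegral_mono_ae (hle.mono fun ζ h => ENNReal.ofReal_le_ofReal h)

open Classical in
/-- Player II's move: pull with full strength against the gradient of the potential of the wedge
whose apex is shifted to `-L`. -/
noncomputable def pull (η ε L : ℝ) (ψ ψ₁ : ℝ → ℝ) (x : ℂ) : ℂ :=
  if x ∈ wedge η then
    ((-(ε / ‖potentialGrad ψ ψ₁ (x + L)‖) : ℝ) : ℂ) * potentialGrad ψ ψ₁ (x + L) else 0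

theorem norm_pull_le {ε : ℝ} (hε : 0 ≤ ε) (L : ℝ) (ψ ψ₁ : ℝ → ℝ) (x : ℂ) :
    ‖pull η ε L ψ ψ₁ x‖ ≤ ε := by
  rw [pull]
  split_ifs
  · rw [norm_mul, Complex.norm_real, norm_neg, Real.norm_of_nonneg (by positivity)]
    rcases eq_or_ne ‖potentialGrad ψ ψ₁ (x + L)‖ 0 with h | h
    · simpa [h] using hε
    · exact (div_mul_cancel₀ _ h).le
  · simpa using hε

theorem continuousOn_comp_arg (h0 : 0 < η) (hπ : η < Real.pi) (hηγ : η / 2 < γ) {f : ℝ → ℝ}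
    (hf : ∀ θ, |θ| < γ → ContinuousAt f θ) {L : ℝ} (hL : 0 ≤ L) :
    ContinuousOn (fun x : ℂ => f (x + L).arg) (wedge η) := by
  intro x hx
  have hxL := add_ofReal_mem_wedge h0 hπ hx hL
  have h1 : ContinuousAt Complex.arg (x + L) :=
    Complex.continuousAt_arg (Or.inl (re_pos_of_mem_wedge h0 hπ hxL))
  have h2 : ContinuousAt (fun x : ℂ => (x + L).arg) x :=
    ContinuousAt.comp (f := fun x : ℂ => x + L) h1 (by fun_prop)
  exact (ContinuousAt.comp (f := fun x : ℂ => (x + L).arg)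
    (hf _ ((abs_lt.2 hxL.2).trans hηγ)) h2).continuousWithinAt

theorem continuousOn_potential (h0 : 0 < η) (hπ : η < Real.pi) (hηγ : η / 2 < γ)
    (hψ : ∀ θ, |θ| < γ → ContinuousAt ψ θ) {L : ℝ} (hL : 0 ≤ L) :
    ContinuousOn (fun x : ℂ => potential ψ (x + L)) (wedge η) := by
  have : Continuous fun x : ℂ => Complex.normSq (x + L) :=
    Complex.continuous_normSq.comp (by fun_prop)
  exact this.continuousOn.mul (continuousOn_comp_arg h0 hπ hηγ hψ hL)

/-- On the wedge `ψ > 0` keeps the gradient nonzero, so the normalized gradient is continuous there.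
-/
theorem measurable_pull (h0 : 0 < η) (hπ : η < Real.pi) (hηγ : η / 2 < γ)
    (hψ : ∀ θ, |θ| < γ → ContinuousAt ψ θ) (hψ₁ : ∀ θ, |θ| < γ → ContinuousAt ψ₁ θ)
    (hψ0 : ∀ θ, |θ| < γ → 0 < ψ θ) (ε : ℝ) {L : ℝ} (hL : 0 ≤ L) :
    Measurable (pull η ε L ψ ψ₁) := by
  classical
  have hg : ContinuousOn (fun x : ℂ => potentialGrad ψ ψ₁ (x + L)) (wedge η) := by
    have e : ∀ x : ℂ, potentialGrad ψ ψ₁ (x + L) = (x + L) *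
        (((2 * ψ (x + L).arg : ℝ) : ℂ) + (ψ₁ (x + L).arg : ℂ) * Complex.I) := fun x => by
      rw [potentialGrad, Complex.mk_eq_add_mul_I]
    simp only [e]
    have h1 := continuousOn_comp_arg h0 hπ hηγ hψ hL
    have h2 := continuousOn_comp_arg h0 hπ hηγ hψ₁ hL
    exact ContinuousOn.mul (by fun_prop) ((Complex.continuous_ofReal.comp_continuousOn
      (h1.const_mul 2)).add ((Complex.continuous_ofReal.comp_continuousOn h2).mul
        continuousOn_const))
  have hne : ∀ x ∈ wedge η, ‖potentialGrad ψ ψ₁ (x + L)‖ ≠ 0 := fun x hx => by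
    have hxL := add_ofReal_mem_wedge h0 hπ hx hL
    have := hψ0 _ ((abs_lt.2 hxL.2).trans hηγ)
    rw [norm_ne_zero_iff, ← Complex.normSq_pos, normSq_potentialGrad]
    exact mul_pos (Complex.normSq_pos.2 hxL.1) (by positivity)
  refine measurable_ite_const_of_continuousOn (isOpen_wedge h0 hπ).measurableSet ?_ 0
  exact (Complex.continuous_ofReal.comp_continuousOn
    ((continuousOn_const.div hg.norm hne).neg)).mul hg

/-- The strategy of player II: pull against the gradient, and end the game at the nearest boundary
point. -/
noncomputable def pullStrategy (μ : Measure ℂ) {ε : ℝ} (h0 : 0 < η) (hπ : η < Real.pi) (hε : 0 ≤ ε)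
    (L : ℝ) (ψ ψ₁ : ℝ → ℝ) (hm : Measurable (pull η ε L ψ ψ₁)) : Strategy μ (wedge η) ε where
  move _ h := pull η ε L ψ ψ₁ h.position
  final _ h := sideProj (η / 2) h.position
  measurable_move _ := hm.comp History.measurable_position
  measurable_final _ := (measurable_sideProj _).comp History.measurable_position
  norm_move_le _ h := norm_pull_le hε L ψ ψ₁ _
  final_mem _ _ hD _ := sideProj_mem_frontier h0 hπ hD
  dist_final_le _ h hD hd := by
    rwa [dist_sideProj ((mem_wedge_iff_depth_pos h0 hπ _).1 hD).le, ← infDist_frontier_wedge h0 hπ hD]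

open Classical in
/-- The Lyapunov function of the game. -/
noncomputable def lyapunov (η L ω : ℝ) (ψ : ℝ → ℝ) (x : ℂ) : ℝ≥0∞ :=
  if x ∈ wedge η then ENNReal.ofReal (potential ψ (x + L) + ω)
  else if x ∈ frontier (wedge η) then 0 else ⊤

theorem measurable_lyapunov (h0 : 0 < η) (hπ : η < Real.pi) (hηγ : η / 2 < γ)
    (hψ : ∀ θ, |θ| < γ → ContinuousAt ψ θ) {L : ℝ} (hL : 0 ≤ L) (ω : ℝ) :
    Measurable (lyapunov η L ω ψ) := by
  classical
  have hW := (isOpen_wedge h0 hπ).measurableSet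
  have h1 : Measurable fun x : ℂ => if x ∈ wedge η then potential ψ (x + L) else 0 :=
    measurable_ite_const_of_continuousOn hW (continuousOn_potential h0 hπ hηγ hψ hL) 0
  have h2 : Measurable fun x : ℂ => if x ∈ frontier (wedge η) then (0 : ℝ≥0∞) else ⊤ :=
    Measurable.ite isClosed_frontier.measurableSet measurable_const measurable_const
  have h3 : Measurable fun x : ℂ => if x ∈ wedge η then
      ENNReal.ofReal ((if x ∈ wedge η then potential ψ (x + L) else 0) + ω)
      else if x ∈ frontier (wedge η) then (0 : ℝ≥0∞) else ⊤ :=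
    Measurable.ite hW (h1.add_const ω).ennreal_ofReal h2
  convert h3 using 1
  ext x
  simp only [lyapunov]
  split_ifs <;> rfl

theorem lyapunov_of_mem {x : ℂ} (hx : x ∈ wedge η) (L ω : ℝ) (ψ : ℝ → ℝ) :
    lyapunov η L ω ψ x = ENNReal.ofReal (potential ψ (x + L) + ω) := if_pos hx

theorem lyapunov_of_mem_frontier (h0 : 0 < η) (hπ : η < Real.pi) {x : ℂ}
    (hx : x ∈ frontier (wedge η)) (L ω : ℝ) (ψ : ℝ → ℝ) : lyapunov η L ω ψ x = 0 := by
  have : x ∉ wedge η := by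
    rw [(isOpen_wedge h0 hπ).frontier_eq] at hx
    exact hx.2
  rw [lyapunov, if_neg this, if_pos hx]

end

theorem half_ofReal_add_le {A B C ω : ℝ} {a b : ℝ≥0∞} (ha : a ≤ ENNReal.ofReal A)
    (hb : b ≤ ENNReal.ofReal B) (hA : 0 ≤ A) (hB : 0 ≤ B) (hω : 0 ≤ ω) (h : A + B + 2 * ω ≤ 2 * C) :
    (a + b) / 2 + ENNReal.ofReal ω ≤ ENNReal.ofReal C := by
  calc (a + b) / 2 + ENNReal.ofReal ω
      ≤ (ENNReal.ofReal A + ENNReal.ofReal B) / 2 + ENNReal.ofReal ω := by gcongr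
    _ = ENNReal.ofReal ((A + B) / 2 + ω) := by
        rw [← ENNReal.ofReal_add hA hB, ENNReal.ofReal_add (by positivity) hω,
          ENNReal.ofReal_div_of_pos two_pos]
        simp
    _ ≤ ENNReal.ofReal C := ENNReal.ofReal_le_ofReal (by linarith)

section
variable {μ : Measure ℂ} {D : Set ℂ} {ε : ℝ}

theorem step_of_mem_frontier (SI SII : Strategy μ D ε) {n : ℕ} {h : History n}
    (hF : h.position ∈ frontier D) (y : Bool × ℂ) : step SI SII n (h, y) = (0, h.position) := by
  rw [step, if_pos hF]

theorem step_mem_frontier_of_infDist_le (SI SII : Strategy μ D ε) {n : ℕ} {h : History n}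
    (hD : h.position ∈ D) (hd : Metric.infDist h.position (frontier D) ≤ reach μ * ε)
    (y : Bool × ℂ) : (step SI SII n (h, y)).2 ∈ frontier D := by
  rw [step]
  split_ifs with h1 h2
  · exact h1
  · exact SI.final_mem n h hD hd
  · exact SII.final_mem n h hD hd

theorem step_snd_of_lt_infDist (SI SII : Strategy μ D ε) {n : ℕ} {h : History n}
    (hF : h.position ∉ frontier D) (hd : reach μ * ε < Metric.infDist h.position (frontier D))
    (b : Bool) (ζ : ℂ) : (step SI SII n (h, (b, ζ))).2 =
      h.position + (if b = true then SI.move n h else SII.move n h) +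
        (if b = true then SI.move n h else SII.move n h) * ζ := by
  rw [step, if_neg hF, if_neg (not_le.2 hd)]

end

/-! ### The drift inequality and the critical angle -/

/-- If a wedge of aperture `η < π` carries a strictly `p`-superharmonic function `r ^ 2 * ψ θ`, then
player II can make the expected end time finite. -/
theorem mem_finiteAngles_of_profile {μ : Measure ℂ} [IsProbabilityMeasure μ]
    (hμ : IsNoiseMeasure μ) {p : ℝ} (hp : 1 < p) (hpμ : exponent μ = p) {ε : ℝ} (hε : 0 < ε)
    {η γ : ℝ} (h0 : 0 < η) (hπ : η < Real.pi) (hηγ : η / 2 < γ) {ψ ψ₁ ψ₂ : ℝ → ℝ}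
    (hprof : ∀ θ, |θ| < γ → HasDerivAt ψ (ψ₁ θ) θ ∧ HasDerivAt ψ₁ (ψ₂ θ) θ ∧
      ContinuousAt ψ₂ θ ∧ 0 < ψ θ ∧
      p * (4 * ψ θ ^ 2 + ψ₁ θ ^ 2) * (4 * ψ θ + ψ₂ θ) -
        (p - 2) * (ψ₂ θ * (4 * ψ θ ^ 2 - ψ₁ θ ^ 2) - 8 * ψ θ * ψ₁ θ ^ 2) < 0) :
    η ∈ finiteAngles μ ε := by
  have hψ : ∀ θ, |θ| < γ → HasDerivAt ψ (ψ₁ θ) θ := fun θ h => (hprof θ h).1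
  have hψ₁ : ∀ θ, |θ| < γ → HasDerivAt ψ₁ (ψ₂ θ) θ := fun θ h => (hprof θ h).2.1
  have hψ₂ : ∀ θ, |θ| < γ → ContinuousAt ψ₂ θ := fun θ h => (hprof θ h).2.2.1
  have hψ0 : ∀ θ, |θ| < γ → 0 < ψ θ := fun θ h => (hprof θ h).2.2.2.1
  have hI : ∀ θ ∈ Set.Icc (-(η / 2)) (η / 2), |θ| < γ := fun θ hθ =>
    (abs_le.2 hθ).trans_lt hηγ
  obtain ⟨m, κ, K, hm, hκ, hbd⟩ := exists_uniform_bounds (p := p) (β := η / 2) (by linarith)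
    (fun θ hθ => (hψ θ (hI θ hθ)).continuousAt.continuousWithinAt)
    (fun θ hθ => (hψ₁ θ (hI θ hθ)).continuousAt.continuousWithinAt)
    (fun θ hθ => (hψ₂ θ (hI θ hθ)).continuousWithinAt)
    (fun θ hθ => hψ0 θ (hI θ hθ)) (fun θ hθ => (hprof θ (hI θ hθ)).2.2.2.2)
  have hC := integral_im_sq_pos hp hpμ
  -- The factor `1/8` leaves room for the Taylor errors of both players and for I's deviation, with
  -- a drop of `ω` to spare.
  set ω := (∫ z, z.im ^ 2 ∂μ) * ε ^ 2 * κ / 8 with hω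
  have hω0 : 0 < ω := by positivity
  have hR : 0 ≤ reach μ * ε := mul_nonneg (zero_le_one.trans (one_le_reach μ)) hε.le
  obtain ⟨L₀, hL₀⟩ := exists_potential_add_le h0 hπ hηγ hψ hψ₁ hψ₂ hR hω0
  -- `L` must exceed `L₀` for the Taylor bound and make the gradient large: its norm is at least
  -- `2mL` on the shifted wedge.
  obtain ⟨L, hL, hLL₀, hLg⟩ : ∃ L : ℝ, 0 ≤ L ∧ L₀ ≤ L ∧
      ((∫ z, z.im ^ 2 ∂μ) * K) ^ 2 * ε ^ 3 ≤ 8 * ω * (L * (2 * m)) := by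
    refine ⟨max (max 0 L₀) (((∫ z, z.im ^ 2 ∂μ) * K) ^ 2 * ε ^ 3 / (16 * ω * m)),
      (le_max_left _ _).trans (le_max_left _ _), (le_max_right _ _).trans (le_max_left _ _), ?_⟩
    have := (div_le_iff₀ (by positivity)).1
      (le_max_right (max 0 L₀) (((∫ z, z.im ^ 2 ∂μ) * K) ^ 2 * ε ^ 3 / (16 * ω * m)))
    linarith
  have hgrad : ∀ z ∈ wedge η, L ≤ z.re → ((∫ z, z.im ^ 2 ∂μ) * K) ^ 2 * ε ^ 3 ≤
      8 * ω * ‖potentialGrad ψ ψ₁ z‖ := by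
    intro z hz hzL
    refine hLg.trans (mul_le_mul_of_nonneg_left ?_ (by positivity))
    rw [potentialGrad, norm_mul]
    refine mul_le_mul (hzL.trans (Complex.re_le_norm z)) ?_ (by positivity) (norm_nonneg _)
    have := (hbd z.arg ⟨hz.2.1.le, hz.2.2.le⟩).1
    exact le_trans (by simpa using this) (Complex.re_le_norm _)
  have hmp : Measurable (pull η ε L ψ ψ₁) := measurable_pull h0 hπ hηγ
    (fun θ h => (hψ θ h).continuousAt) (fun θ h => (hψ₁ θ h).continuousAt) hψ0 ε hL
  have hΦ : Measurable (lyapunov η L ω ψ) :=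
    measurable_lyapunov h0 hπ hηγ (fun θ h => (hψ θ h).continuousAt) hL ω
  refine ⟨⟨h0, by linarith [Real.pi_pos]⟩, pullStrategy μ h0 hπ hε.le L ψ ψ₁ hmp,
    fun SI x₀ hx₀ => ?_⟩
  set SII := pullStrategy μ h0 hπ hε.le L ψ ψ₁ hmp with hSII
  have hstep : ∀ n (h : History n), ∫⁻ y, lyapunov η L ω ψ y.2 ∂transition SI SII n h +
      ENNReal.ofReal ω * (frontier (wedge η))ᶜ.indicator (fun _ => 1) h.position ≤
      lyapunov η L ω ψ h.position := by
    intro n h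
    rw [lintegral_transition SI SII n h (f := fun y => lyapunov η L ω ψ y.2)
      (hΦ.comp measurable_snd)]
    by_cases hF : h.position ∈ frontier (wedge η)
    · simp only [step_of_mem_frontier SI SII hF, lyapunov_of_mem_frontier h0 hπ hF]
      simp [hF]
    by_cases hW : h.position ∈ wedge η
    swap
    -- The inequality is needed for all histories, including those the game never reaches; the value
    -- `⊤` makes it trivial there.
    · rw [lyapunov, if_neg hW, if_neg hF]
      exact le_top
    rw [Set.indicator_of_mem (show h.position ∈ (frontier (wedge η))ᶜ from hF), mul_one,
      lyapunov_of_mem hW]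
    set z := h.position + (L : ℂ) with hz
    have hzW : z ∈ wedge η := add_ofReal_mem_wedge h0 hπ hW hL
    have hzI : z.arg ∈ Set.Icc (-(η / 2)) (η / 2) := ⟨hzW.2.1.le, hzW.2.2.le⟩
    have hzL : L ≤ z.re := by
      rw [hz, Complex.add_re, Complex.ofReal_re]
      linarith [re_pos_of_mem_wedge h0 hπ hW]
    have hpot : 0 ≤ potential ψ z := mul_nonneg (Complex.normSq_nonneg _) (hψ0 _ (hI _ hzI)).le
    rcases le_or_gt (Metric.infDist h.position (frontier (wedge η))) (reach μ * ε) with hd | hd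
    -- On the last turn the value falls to `0`; the summand `ω` in the Lyapunov function pays for
    -- that turn.
    · simp only [lyapunov_of_mem_frontier h0 hπ (step_mem_frontier_of_infDist_le SI SII hW hd _)]
      simp only [lintegral_zero, add_zero, ENNReal.zero_div, zero_add]
      exact ENNReal.ofReal_le_ofReal (by linarith)
    have hmem' : ∀ k : ℂ, ‖k‖ ≤ reach μ * ε → h.position + k ∈ wedge η := fun k hk =>
      add_mem_wedge_of_norm_lt_infDist h0 hπ hW (hk.trans_lt hd)
    have hmem : ∀ k : ℂ, ‖k‖ ≤ reach μ * ε → z + k ∈ wedge η := fun k hk => by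
      rw [hz, add_right_comm]
      exact add_ofReal_mem_wedge h0 hπ (hmem' k hk) hL
    have htaylor : ∀ k : ℂ, ‖k‖ ≤ reach μ * ε → potential ψ (z + k) ≤ potential ψ z +
        (k * conj (potentialGrad ψ ψ₁ z)).re + (hess ψ ψ₁ ψ₂ z.arg k + ω) / 2 := fun k hk => by
      refine hL₀ z k (hLL₀.trans hzL) hk fun s hs => hmem _ ?_
      rw [norm_mul, Complex.norm_real, Real.norm_of_nonneg hs.1]
      exact (mul_le_of_le_one_left (norm_nonneg k) hs.2).trans hk
    have hlint : ∀ v : ℂ, ‖v‖ ≤ ε →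
        ∫⁻ ζ, lyapunov η L ω ψ (h.position + v + v * ζ) ∂μ =
          ∫⁻ ζ, ENNReal.ofReal (potential ψ (z + v + v * ζ) + ω) ∂μ := by
      intro v hv
      apply lintegral_congr_ae
      filter_upwards [ae_norm_le_reach hμ] with ζ hζ
      have hk : ‖v + v * ζ‖ ≤ reach μ * ε := by
        calc ‖v + v * ζ‖ ≤ ‖v‖ + ‖v‖ * ‖ζ‖ := (norm_add_le _ _).trans_eq (by rw [norm_mul])
          _ = (1 + ‖ζ‖) * ‖v‖ := by ring
          _ ≤ reach μ * ε := mul_le_mul hζ hv (norm_nonneg _) (by linarith [one_le_reach μ])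
      have hk' := hmem' _ hk
      rw [← add_assoc] at hk'
      rw [lyapunov_of_mem hk', hz]
      congr 3
      ring
    have hI' := lintegral_potential_le hμ hp hpμ hψ0 hηγ hω0 (SI.norm_move_le n h) hmem htaylor
    have hII' := lintegral_potential_le hμ hp hpμ hψ0 hηγ hω0 (SII.norm_move_le n h) hmem htaylor
    rw [← hlint _ (SI.norm_move_le n h)] at hI'
    rw [← hlint _ (SII.norm_move_le n h)] at hII'
    simp only [step_snd_of_lt_infDist SI SII hF hd, if_true, Bool.false_eq_true, if_false]
    refine half_ofReal_add_le hI'.2 hII'.2 hI'.1 hII'.1 hω0.le ?_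
    have hmove : SII.move n h = ((-(ε / ‖potentialGrad ψ ψ₁ z‖) : ℝ) : ℂ) *
        potentialGrad ψ ψ₁ z := if_pos hW
    rw [hmove]
    have := mean_change_le (μ := μ) (ω := ω) (by linarith : 0 ≤ p) hzW.1 (hψ0 _ (hI _ hzI)) hε
      (hbd _ hzI).2.1 (hbd _ hzI).2.2 (by rw [hω]; linarith) (hgrad z hzW hzL)
      (SI.norm_move_le n h)
    linarith
  have hfin := mul_expectedEndTime_le SI SII hΦ (ENNReal.ofReal ω) hstep x₀
  rw [lyapunov_of_mem hx₀] at hfin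
  exact ENNReal.lt_top_of_mul_ne_top_right (hfin.trans_lt ENNReal.ofReal_lt_top).ne
    (ENNReal.ofReal_pos.2 hω0).ne'

/-- The bound for the critical angle is continuous in the exponent. -/
theorem exists_exponent_gt {p γ : ℝ} (hp : 1 < p)
    (hγ : γ < Real.pi / 2 * (1 - Real.sqrt ((p - 1) / (2 * p)))) :
    ∃ q, p < q ∧ γ < Real.pi / 2 * (1 - Real.sqrt ((q - 1) / (2 * q))) := by
  have hcont : ContinuousAt (fun q : ℝ => Real.pi / 2 * (1 - Real.sqrt ((q - 1) / (2 * q)))) p := by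
    have : (2 * p) ≠ 0 := by linarith
    fun_prop (disch := exact this)
  have h1 := hcont.eventually (lt_mem_nhds hγ)
  obtain ⟨q, hq, hq'⟩ := ((h1.filter_mono nhdsWithin_le_nhds).and
    (self_mem_nhdsWithin (s := Set.Ioi p))).exists
  exact ⟨q, hq', hq⟩

end TugOfWar

theorem corollary1p4 (μ : MeasureTheory.Measure ℂ) [MeasureTheory.IsProbabilityMeasure μ]
    (hμ : TugOfWar.IsNoiseMeasure μ) (p : ℝ) (hp : 1 < p) (hpμ : TugOfWar.exponent μ = p)
    (ε : ℝ) (hε : 0 < ε) :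
    Real.pi * (1 - 1 / 2 * Real.sqrt (2 * (p - 1) / p)) ≤ TugOfWar.criticalAngle μ ε := by
  have hsqrt : 1 / 2 * Real.sqrt (2 * (p - 1) / p) = Real.sqrt ((p - 1) / (2 * p)) := by
    have h4 : 2 * (p - 1) / p = 2 ^ 2 * ((p - 1) / (2 * p)) := by
      field_simp
    rw [h4, Real.sqrt_mul (by norm_num), Real.sqrt_sq (by norm_num)]
    ring
  rw [hsqrt]
  have hk0 : 0 < Real.sqrt ((p - 1) / (2 * p)) :=
    Real.sqrt_pos.2 (div_pos (by linarith) (by linarith))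
  have hk1 : Real.sqrt ((p - 1) / (2 * p)) < 1 := by
    rw [Real.sqrt_lt' one_pos, div_lt_iff₀ (by linarith)]
    linarith
  -- A real `sSup` bounds its set from above only if the set is bounded.
  have hbdd : BddAbove (TugOfWar.finiteAngles μ ε) := ⟨2 * Real.pi, fun η hη => hη.1.2.le⟩
  have hmem : ∀ η, 0 < η → η < Real.pi * (1 - Real.sqrt ((p - 1) / (2 * p))) →
      η ∈ TugOfWar.finiteAngles μ ε := by
    intro η h0 hη
    obtain ⟨q, hpq, hq⟩ := TugOfWar.exists_exponent_gt hp (γ := η / 2) (by linarith)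
    obtain ⟨ψ, ψ₁, ψ₂, hprof⟩ := TugOfWar.exists_profile hp hpq
    refine TugOfWar.mem_finiteAngles_of_profile hμ hp hpμ hε h0 ?_ hq hprof
    exact hη.trans (mul_lt_of_lt_one_right Real.pi_pos (by linarith))
  have hpos : 0 < Real.pi * (1 - Real.sqrt ((p - 1) / (2 * p))) :=
    mul_pos Real.pi_pos (by linarith)
  refine le_of_forall_lt fun c hc => ?_
  -- The maximum with `0` keeps `η` positive when `c` is negative.
  obtain ⟨η, hη, hη'⟩ := exists_between (max_lt hc hpos)
  exact ((le_max_left _ _).trans_lt hη).trans_le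
    (le_csSup hbdd (hmem η ((le_max_right _ _).trans_lt hη) hη'))
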